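/- Let $n\ge d\ge 1$ and let $0\le i_1<\dots<i_d\le n$ be any indices. For random vectors $X_1,X_2,\dots$ in $\mathbb R^d$ write $S_0:=0$, $S_k:=X_1+\dots+X_k$, $C_n:=\operatorname{conv}(S_0,S_1,\dots,S_n)$, and let $\mathcal F_n$ be the set of all $(d-1)$-dimensional faces of $C_n$. Random vectors $X_1,\dots,X_m$ are called $m$-exchangeable if $(X_{\sigma(1)},\dots,X_{\sigma(m)})$ has the same distribution as $(X_1,\dots,X_m)$ for every permutation $\sigma$ of $\{1,\dots,m\}$. Consider the conditions (G) with probability one, $S_1,\dots,S_n$ are in general position, that is, any $d$ of these vectors are linearly independent; (H) $\mathbb P(X_1\in h)=0$ for any affine hyperplane $h\subset\mathbb R^d$; (S) $X_1$ and $-X_1$ have the same distribution. 1. If $X_1,\dots,X_n$ are $n$-exchangeable and (G) holds, then $$\sum_{i=0}^{n-i_d+i_1}\mathbb P\bigl(\operatorname{conv}(S_i,S_{i+i_2-i_1},\dots,S_{i+i_d-i_1})\in\mathcal F_n\bigr)=\frac{2}{\prod_{k=1}^{d-1}(i_{k+1}-i_k)}.$$ Moreover, if $X_1,\dots,X_{n+1}$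 are $(n+1)$-exchangeable, $S_{n+1}=0$ almost surely (so that $S_1,\dots,S_{n+1}$ is a random bridge of length $n+1$), and (G) holds, then $$\mathbb P\bigl(\operatorname{conv}(S_{i_1},\dots,S_{i_d})\in\mathcal F_n\bigr)=\frac{2}{(n-i_d+i_1+1)\prod_{k=1}^{d-1}(i_{k+1}-i_k)}.$$ 2. If $X_1,\dots,X_n$ are independent and identically distributed and (H) and (S) hold, then $$\mathbb P\bigl(\operatorname{conv}(S_{i_1},\dots,S_{i_d})\in\mathcal F_n\bigr)=2\,\frac{(2i_1-1)!!}{(2i_1)!!}\,\frac{(2n-2i_d-1)!!}{(2n-2i_d)!!}\prod_{k=1}^{d-1}\frac1{i_{k+1}-i_k},$$ where $(-1)!!=0!!=1$. The same formula holds if $X_1,\dots,X_n$ are $n$-exchangeable, (G) holds, and all the $2^n$ tuples $(\pm X_1,\dots,\pm X_n)$ have the same distribution. -/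

import Mathlib

open MeasureTheory ProbabilityTheory
open scoped Nat

noncomputable section

/-- The `k`-th partial sum `S_k = X_1 + ⋯ + X_k` of the increments `X_1, …, X_m`, where the
increment `X_{j+1}` is `X j` for `j : Fin m`. In particular `S_0 = 0`. -/
def partialSum {Ω : Type*} {d m : ℕ} (X : Fin m → Ω → EuclideanSpace ℝ (Fin d))
    (k : ℕ) (ω : Ω) : EuclideanSpace ℝ (Fin d) :=
  ∑ j : Fin m with j.val < k, X j ω

/-- The convex hull `C_n = conv (s_0, s_1, …, s_n)`. -/
def hullUpTo {d : ℕ} (s : ℕ → EuclideanSpace ℝ (Fin d)) (n : ℕ) :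
    Set (EuclideanSpace ℝ (Fin d)) :=
  convexHull ℝ (s '' Set.Icc 0 n)

/-- The set of all `(d - 1)`-dimensional faces of a convex polytope `C ⊆ ℝ^d`: the nonempty
subsets of `C` on which some linear functional attains its maximum over `C`, and whose affine
span has dimension `d - 1`. -/
def facets {d : ℕ} (C : Set (EuclideanSpace ℝ (Fin d))) :
    Set (Set (EuclideanSpace ℝ (Fin d))) :=
  {f | f.Nonempty ∧ IsExposed ℝ C f ∧ Module.finrank ℝ (vectorSpan ℝ f) + 1 = d}

/-- The vectors `s_1, …, s_n` of `ℝ^d` are in general position: any `d` of them are linearly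
independent. -/
def InGeneralPosition {d : ℕ} (s : ℕ → EuclideanSpace ℝ (Fin d)) (n : ℕ) : Prop :=
  ∀ k : Fin d → ℕ, Function.Injective k → (∀ j, 1 ≤ k j ∧ k j ≤ n) →
    LinearIndependent ℝ (fun j => s (k j))

/-- The random vectors `X_1, …, X_m` are exchangeable: every permutation of the tuple has the
same joint distribution. -/
def Exchangeable {Ω : Type*} [MeasurableSpace Ω] (μ : Measure Ω) {d m : ℕ}
    (X : Fin m → Ω → EuclideanSpace ℝ (Fin d)) : Prop :=
  ∀ σ : Equiv.Perm (Fin m),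
    IdentDistrib (fun ω j => X (σ j) ω) (fun ω j => X j ω) μ μ

/-- All the `2^m` tuples `(± X_1, …, ± X_m)` have the same joint distribution. -/
def SignInvariant {Ω : Type*} [MeasurableSpace Ω] (μ : Measure Ω) {d m : ℕ}
    (X : Fin m → Ω → EuclideanSpace ℝ (Fin d)) : Prop :=
  ∀ ε : Fin m → ℝ, (∀ j, ε j = 1 ∨ ε j = -1) →
    IdentDistrib (fun ω j => ε j • X j ω) (fun ω j => X j ω) μ μ

/-- The random vector `Y` lies in any given affine hyperplane `{x | ⟪u, x⟫ = c}`, `u ≠ 0`, with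
probability zero. -/
def NullOnHyperplanes {Ω : Type*} [MeasurableSpace Ω] (μ : Measure Ω) {d : ℕ}
    (Y : Ω → EuclideanSpace ℝ (Fin d)) : Prop :=
  ∀ u : EuclideanSpace ℝ (Fin d), u ≠ 0 → ∀ c : ℝ, μ {ω | inner ℝ u (Y ω) = c} = 0

/-- The event that `conv (S_{i_1}, …, S_{i_d})` is a `(d - 1)`-dimensional face of
`C_n = conv (S_0, S_1, …, S_n)`. -/
def faceEvent {Ω : Type*} {d : ℕ} (S : ℕ → Ω → EuclideanSpace ℝ (Fin d)) (n : ℕ)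
    (i : ℕ → ℕ) : Set Ω :=
  {ω | convexHull ℝ ((fun k => S (i k) ω) '' Set.Icc 1 d) ∈ facets (hullUpTo (fun k => S k ω) n)}

end

/-!
Let `I = {i_1 < ⋯ < i_d}`. Almost surely the points `S_i`, `i ∈ I`, span a hyperplane, and their
hull is a facet exactly if all the other points of the walk lie strictly on one side of it
(`convexHull_mem_facets_iff`). A normal functional of this hyperplane is `w ↦ det (v_1, …,
v_{d-1}, w)`, where `v_k = S_{i_{k+1}} - S_{i_k}` (`normalForm`). It depends on the walk only
through the sums `v_k` of the increments over the `d - 1` blocks between consecutive times in `I`,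
hence is unchanged by permutations within a block and by permutations and sign changes of the
increments outside the blocks. The heights of the walk over the hyperplane thus behave like real
walks with exchangeable increments, separately in each block and outside the blocks. General
position excludes ties between these heights (`ae_normalForm_ne_zero`).

In a block of length `ℓ` the height is a bridge, and exactly one of the `ℓ` cyclic shifts of the
block, the one starting at its minimum, makes the bridge positive. So each block contributes a
factor `1 / ℓ` (`measureReal_inter_blockOnSide`). Once the blocks are moved to the front of the
walk (`onSide_iff_frontPerm`), the condition on the remaining `m = n - i_d + i_1` increments is
that the real walk formed by their heights attains its minimum at time `i_1`
(`measureReal_onSide_mul_prod`). Shifting `I` only changes the prescribed time of the minimum, and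
the probabilities of all `m + 1` times sum to `1`; the two sides of the hyperplane give the factor
`2`. For a bridge of length `n + 1`, cyclic shifts of all the increments show that each shift of
`I` has the same probability.

If all sign changes preserve the law, the minimum of the real walk is at time `s` with probability
`p_s p_{m-s}`, where `p_a = (2a-1)!! / (2a)!!`. This is Sparre Andersen's theorem (`persistLaw`),
which follows by induction: the parts before and after the minimum decouple, and `∑ p_s p_{m-s} =
1`. Independent symmetric increments without mass on hyperplanes are a special case, as they are
in general position almost surely (`ae_inGeneralPosition_of_iIndepFun`).
-/

/-! ### Double factorial ratios -/

/-- The ratio `(2a-1)!! / (2a)!!`, the probability that a symmetric random walk without ties stays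
positive during its first `a` steps. -/
noncomputable def persistProb (a : ℕ) : ℝ := ((2 * a - 1)‼ : ℝ) / ((2 * a)‼ : ℝ)

lemma persistProb_zero : persistProb 0 = 1 := by simp [persistProb]

lemma persistProb_succ (a : ℕ) :
    ((a : ℝ) + 1) * persistProb (a + 1) = ((a : ℝ) + 1 / 2) * persistProb a := by
  have h1 : (2 * (a + 1))‼ = (2 * a + 2) * (2 * a)‼ := Nat.doubleFactorial_add_two (2 * a)
  have h2 : (2 * (a + 1) - 1)‼ = (2 * a + 1) * (2 * a - 1)‼ := by
    rcases a with _ | a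
    · rfl
    · exact Nat.doubleFactorial_add_two (2 * a + 1)
  have h3 : (((2 * a)‼ : ℕ) : ℝ) ≠ 0 := by
    exact_mod_cast (Nat.doubleFactorial_pos (2 * a)).ne'
  unfold persistProb
  rw [h1, h2]
  push_cast
  have h4 : (2 * (a : ℝ) + 2) ≠ 0 := by positivity
  field_simp

lemma sum_antidiagonal_fst_mul_persistProb (m : ℕ) :
    ∑ q ∈ Finset.HasAntidiagonal.antidiagonal m, (q.1 : ℝ) * (persistProb q.1 * persistProb q.2)
      = (m : ℝ) / 2 *
        ∑ q ∈ Finset.HasAntidiagonal.antidiagonal m, persistProb q.1 * persistProb q.2 := by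
  have hswap :
      ∑ q ∈ Finset.HasAntidiagonal.antidiagonal m, (q.2 : ℝ) * (persistProb q.1 * persistProb q.2)
      = ∑ q ∈ Finset.HasAntidiagonal.antidiagonal m,
        (q.1 : ℝ) * (persistProb q.1 * persistProb q.2) := by
    rw [← Finset.Nat.sum_antidiagonal_swap]
    exact Finset.sum_congr rfl fun q _ => by rw [Prod.snd_swap, Prod.fst_swap]; ring
  have hadd :
      ∑ q ∈ Finset.HasAntidiagonal.antidiagonal m, (q.1 : ℝ) * (persistProb q.1 * persistProb q.2)
      + ∑ q ∈ Finset.HasAntidiagonal.antidiagonal m, (q.2 : ℝ) * (persistProb q.1 * persistProb q.2)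
      = m * ∑ q ∈ Finset.HasAntidiagonal.antidiagonal m, persistProb q.1 * persistProb q.2 := by
    rw [← Finset.sum_add_distrib, Finset.mul_sum]
    refine Finset.sum_congr rfl fun q hq => ?_
    rw [← Finset.HasAntidiagonal.mem_antidiagonal.1 hq]
    push_cast
    ring
  linarith

lemma sum_antidiagonal_persistProb (m : ℕ) :
    ∑ q ∈ Finset.HasAntidiagonal.antidiagonal m, persistProb q.1 * persistProb q.2 = 1 := by
  induction m with
  | zero => simp [persistProb_zero]
  | succ m ih =>
    have h1 := sum_antidiagonal_fst_mul_persistProb (m + 1)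
    rw [Finset.Nat.antidiagonal_succ, Finset.sum_cons, Finset.sum_map,
      ← Finset.Nat.antidiagonal_succ] at h1
    have h2 : ∑ q ∈ Finset.HasAntidiagonal.antidiagonal m,
        ((q.1 : ℝ) + 1) * (persistProb (q.1 + 1) * persistProb q.2)
        = ((m : ℝ) + 1) / 2 := by
      have : ∀ q ∈ Finset.HasAntidiagonal.antidiagonal m,
          ((q.1 : ℝ) + 1) * (persistProb (q.1 + 1) * persistProb q.2)
          = (q.1 : ℝ) * (persistProb q.1 * persistProb q.2)
            + 1 / 2 * (persistProb q.1 * persistProb q.2) := fun q _ => by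
        rw [← mul_assoc, persistProb_succ]; ring
      rw [Finset.sum_congr rfl this, Finset.sum_add_distrib, ← Finset.mul_sum,
        sum_antidiagonal_fst_mul_persistProb, ih]
      ring
    simp at h1
    rw [h2] at h1
    have h3 : ((m : ℝ) + 1) ≠ 0 := by positivity
    field_simp at h1
    linarith

/-! ### Walks and invariant measures on path space -/

/-- The partial sums of a sequence of increments. -/
def walk {V : Type*} [AddCommMonoid V] (x : ℕ → V) (k : ℕ) : V := ∑ j ∈ Finset.range k, x j

@[simp] lemma walk_zero {V : Type*} [AddCommMonoid V] (x : ℕ → V) : walk x 0 = 0 := by simp [walk]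

lemma walk_succ {V : Type*} [AddCommMonoid V] (x : ℕ → V) (k : ℕ) :
    walk x (k + 1) = walk x k + x k := Finset.sum_range_succ _ _

lemma walk_add {V : Type*} [AddCommMonoid V] (x : ℕ → V) (a k : ℕ) :
    walk x (a + k) = walk x a + walk (fun j => x (a + j)) k := Finset.sum_range_add _ _ _

lemma walk_congr {V : Type*} [AddCommMonoid V] {x y : ℕ → V} {k : ℕ}
    (h : ∀ j < k, x j = y j) : walk x k = walk y k :=
  Finset.sum_congr rfl fun j hj => h j (Finset.mem_range.1 hj)

lemma map_walk {V W : Type*} [AddCommMonoid V] [AddCommMonoid W] [Module ℝ V] [Module ℝ W]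
    (f : V →ₗ[ℝ] W) (x : ℕ → V) (k : ℕ) : walk (fun j => f (x j)) k = f (walk x k) :=
  (map_sum f _ _).symm

lemma measurable_walk {V : Type*} [AddCommMonoid V] [MeasurableSpace V] [MeasurableAdd₂ V]
    (k : ℕ) : Measurable fun x : ℕ → V => walk x k :=
  Finset.measurable_sum _ fun j _ => measurable_pi_apply j

/-- A measure on path space is invariant under permutations of the first `n` increments. -/
def PermInvariant {V : Type*} [MeasurableSpace V] (n : ℕ) (ν : Measure (ℕ → V)) : Prop :=
  ∀ σ : Equiv.Perm ℕ, (∀ j, n ≤ j → σ j = j) → MeasurePreserving (fun x => x ∘ σ) ν ν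

/-- A measure on path space is invariant under sign changes of the first `n` increments. -/
def FlipInvariant {V : Type*} [MeasurableSpace V] [SMul ℝ V] (n : ℕ) (ν : Measure (ℕ → V)) :
    Prop :=
  ∀ ε : ℕ → ℝ, (∀ j, ε j = 1 ∨ ε j = -1) → (∀ j, n ≤ j → ε j = 1) →
    MeasurePreserving (fun x j => ε j • x j) ν ν

lemma measurable_comp_index {V : Type*} [MeasurableSpace V] (f : ℕ → ℕ) :
    Measurable fun x : ℕ → V => x ∘ f :=
  measurable_pi_lambda _ fun j => measurable_pi_apply (f j)

lemma measurable_flip {V : Type*} [MeasurableSpace V] [SMul ℝ V] [MeasurableConstSMul ℝ V]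
    (ε : ℕ → ℝ) : Measurable fun (x : ℕ → V) j => ε j • x j :=
  measurable_pi_lambda _ fun j => (measurable_pi_apply j).const_smul (ε j)

/-- Invariance of a measure is inherited, along an equivariant map, by the image of its restriction
to an invariant event. -/
lemma MeasurePreserving.map_restrict_of_semiconj {α β : Type*} [MeasurableSpace α]
    [MeasurableSpace β] {κ : Measure α} {T : α → α} {T' : β → β} {B : Set α} {g : α → β}
    (hT : MeasurePreserving T κ κ) (hB : MeasurableSet B) (hTB : T ⁻¹' B = B)
    (hg : Measurable g) (hT' : Measurable T') (h : ∀ x, g (T x) = T' (g x)) :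
    MeasurePreserving T' ((κ.restrict B).map g) ((κ.restrict B).map g) := by
  refine ⟨hT', ?_⟩
  have h1 := (hT.restrict_preimage hB).map_eq
  rw [hTB] at h1
  rw [Measure.map_map hT' hg]
  conv_rhs => rw [← h1, Measure.map_map hg hT.measurable]
  congr 1
  ext x
  exact (h x).symm

/-- If almost every point of `G` lies in exactly one of finitely many subsets of `G`, then their
measures add up to that of `G`. -/
lemma sum_measureReal_of_existsUnique {α : Type*} [MeasurableSpace α] {κ : Measure α}
    [IsFiniteMeasure κ] {G : Set α} {s : Finset ℕ} {A : ℕ → Set α}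
    (hA : ∀ c ∈ s, MeasurableSet (A c)) (hAG : ∀ c ∈ s, A c ⊆ G)
    (h : ∀ᵐ x ∂κ, x ∈ G → ∃! c, c ∈ s ∧ x ∈ A c) :
    ∑ c ∈ s, κ.real (A c) = κ.real G := by
  rw [← measureReal_biUnion_finset₀]
  · refine measureReal_congr ?_
    filter_upwards [h] with x hx
    refine propext ⟨fun hx' => ?_, fun hx' => ?_⟩
    · obtain ⟨c, hc, hxc⟩ := Set.mem_iUnion₂.1 hx'
      exact hAG c hc hxc
    · obtain ⟨c, ⟨hc, hxc⟩, -⟩ := hx hx'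
      exact Set.mem_iUnion₂.2 ⟨c, hc, hxc⟩
  · intro c hc c' hc' hcc
    have : κ {x | ¬ (x ∈ G → ∃! c, c ∈ s ∧ x ∈ A c)} = 0 := h
    refine measure_mono_null (fun x hx => ?_) this
    intro hG
    obtain ⟨e, -, he⟩ := hG (hAG c hc hx.1)
    exact hcc ((he c ⟨hc, hx.1⟩).trans (he c' ⟨hc', hx.2⟩).symm)
  · exact fun c hc => (hA c hc).nullMeasurableSet

/-! ### The position of the minimum of a real walk -/

/-- Real walks whose minimum over the times `0, …, m` is attained at time `s` only. -/
def minAt (m s : ℕ) : Set (ℕ → ℝ) := {y | ∀ k ≤ m, k ≠ s → walk y s < walk y k}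

/-- Almost surely the walk takes distinct values at the times `0, …, m`. -/
def TieFree (m : ℕ) (κ : Measure (ℕ → ℝ)) : Prop :=
  ∀ᵐ y ∂κ, ∀ p q, p < q → q ≤ m → walk y p ≠ walk y q

lemma measurableSet_minAt (m s : ℕ) : MeasurableSet (minAt m s) := by
  simp only [minAt, Set.ofPred_forall]
  exact MeasurableSet.iInter fun k => MeasurableSet.iInter fun _ => MeasurableSet.iInter fun _ =>
    measurableSet_lt (measurable_walk s) (measurable_walk k)

lemma tieFree_map {α : Type*} [MeasurableSpace α] {κ : Measure α} {m : ℕ} {g : α → ℕ → ℝ}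
    (hg : Measurable g)
    (h : ∀ᵐ x ∂κ, ∀ p q, p < q → q ≤ m → walk (g x) p ≠ walk (g x) q) : TieFree m (κ.map g) := by
  rw [TieFree, ae_map_iff hg.aemeasurable]
  · exact h
  · simp only [Set.ofPred_forall]
    exact MeasurableSet.iInter fun p => MeasurableSet.iInter fun q => MeasurableSet.iInter fun _ =>
      MeasurableSet.iInter fun _ =>
        (measurableSet_eq_fun (measurable_walk p) (measurable_walk q)).compl

lemma exists_unique_min {m : ℕ} {w : ℕ → ℝ} (h : ∀ p q, p < q → q ≤ m → w p ≠ w q) :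
    ∃! s, s ∈ Finset.range (m + 1) ∧ ∀ k ≤ m, k ≠ s → w s < w k := by
  obtain ⟨s, hs, hmin⟩ := Finset.exists_min_image (Finset.range (m + 1)) w ⟨0, by simp⟩
  simp only [Finset.mem_range] at hs hmin
  refine ⟨s, ⟨by simpa using hs, fun k hk hks => lt_of_le_of_ne (hmin k (by omega)) ?_⟩, ?_⟩
  · rcases lt_or_gt_of_ne hks with hlt | hlt
    · exact (h k s hlt (by omega)).symm
    · exact h s k hlt hk
  · rintro t ⟨ht, htmin⟩
    by_contra hne
    have := htmin s (by omega) (Ne.symm hne)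
    have := hmin t (by simpa using ht)
    linarith

lemma sum_measureReal_minAt {m : ℕ} {κ : Measure (ℕ → ℝ)} [IsFiniteMeasure κ]
    (h : TieFree m κ) : ∑ s ∈ Finset.range (m + 1), κ.real (minAt m s) = κ.real Set.univ := by
  refine sum_measureReal_of_existsUnique (fun s _ => measurableSet_minAt m s)
    (fun _ _ => Set.subset_univ _) ?_
  filter_upwards [h] with y hy _
  exact exists_unique_min hy

/-- Reversal of the first `s` natural numbers. -/
def revPerm (s : ℕ) : Equiv.Perm ℕ where
  toFun j := if j < s then s - 1 - j else j
  invFun j := if j < s then s - 1 - j else j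
  left_inv j := by dsimp only; split_ifs <;> omega
  right_inv j := by dsimp only; split_ifs <;> omega

/-- The permutation `σ` acting on the natural numbers from `s` on. -/
def shiftPerm (s : ℕ) (σ : Equiv.Perm ℕ) : Equiv.Perm ℕ where
  toFun j := if j < s then j else s + σ (j - s)
  invFun j := if j < s then j else s + σ.symm (j - s)
  left_inv j := by by_cases h : j < s <;> simp [h]; omega
  right_inv j := by by_cases h : j < s <;> simp [h]; omega

lemma revPerm_of_lt {s j : ℕ} (h : j < s) : revPerm s j = s - 1 - j := if_pos h
lemma revPerm_of_le {s j : ℕ} (h : s ≤ j) : revPerm s j = j := if_neg (by omega)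
lemma revPerm_revPerm (s j : ℕ) : revPerm s (revPerm s j) = j := (revPerm s).left_inv j
lemma shiftPerm_of_lt {s j : ℕ} (σ : Equiv.Perm ℕ) (h : j < s) : shiftPerm s σ j = j := if_pos h
lemma shiftPerm_add (s j : ℕ) (σ : Equiv.Perm ℕ) : shiftPerm s σ (s + j) = s + σ j := by
  simp [shiftPerm]

/-- The increments of the walk seen backwards from time `s`. -/
def backward (s : ℕ) (y : ℕ → ℝ) : ℕ → ℝ := fun j => -y (revPerm s j)

lemma walk_backward {s k : ℕ} (hk : k ≤ s) (y : ℕ → ℝ) :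
    walk (backward s y) k = walk y (s - k) - walk y s := by
  induction k with
  | zero => simp
  | succ k ih =>
    have : s - k = s - (k + 1) + 1 := by omega
    rw [walk_succ, ih (by omega), this, walk_succ, backward, revPerm_of_lt (by omega),
      show s - 1 - k = s - (k + 1) by omega]
    ring

lemma walk_forward (s k : ℕ) (y : ℕ → ℝ) :
    walk (fun j => y (s + j)) k = walk y (s + k) - walk y s := by
  rw [walk_add]; ring

lemma measurable_backward (s : ℕ) : Measurable (backward s) :=
  measurable_pi_lambda _ fun j => (measurable_pi_apply (revPerm s j)).neg

lemma mem_minAt_add_iff (s t : ℕ) (y : ℕ → ℝ) :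
    y ∈ minAt (s + t) s ↔ backward s y ∈ minAt s 0 ∧ (fun j => y (s + j)) ∈ minAt t 0 := by
  simp only [minAt, Set.mem_ofPred_eq, walk_zero]
  constructor
  · refine fun h => ⟨fun k hk hk0 => ?_, fun k hk hk0 => ?_⟩
    · rw [walk_backward hk]
      linarith [h (s - k) (by omega) (by omega)]
    · rw [walk_forward]
      linarith [h (s + k) (by omega) (by omega)]
  · rintro ⟨h1, h2⟩ k hk hks
    rcases lt_or_gt_of_ne hks with hlt | hlt
    · have := h1 (s - k) (by omega) (by omega)
      rw [walk_backward (by omega), show s - (s - k) = k by omega] at this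
      linarith
    · have := h2 (k - s) (by omega) (by omega)
      rw [walk_forward, show s + (k - s) = k by omega] at this
      linarith

lemma minAt_zero_congr {t : ℕ} {y z : ℕ → ℝ} (h : ∀ j < t, y j = z j) :
    y ∈ minAt t 0 ↔ z ∈ minAt t 0 := by
  have : ∀ k ≤ t, walk y k = walk z k := fun k hk => walk_congr fun j hj => h j (by omega)
  simp only [minAt, Set.mem_ofPred_eq, walk_zero]
  exact forall₂_congr fun k hk => by rw [this k hk]

/-- The value which the probability of staying positive takes for every sign invariant
exchangeable walk of `m` steps without ties. -/
def PersistLaw (m : ℕ) : Prop :=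
  ∀ κ : Measure (ℕ → ℝ), IsFiniteMeasure κ → PermInvariant m κ → FlipInvariant m κ →
    TieFree m κ → κ.real (minAt m 0) = persistProb m * κ.real Set.univ

/-- The parts of a sign invariant exchangeable walk before and after time `s` behave like
independent walks: given the later part, the earlier one is still sign invariant and
exchangeable. -/
lemma measureReal_minAt_of_persistLaw {s t : ℕ} (hs : PersistLaw s) (ht : PersistLaw t)
    {κ : Measure (ℕ → ℝ)} [IsFiniteMeasure κ] (hperm : PermInvariant (s + t) κ)
    (hflip : FlipInvariant (s + t) κ) (htie : TieFree (s + t) κ) :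
    κ.real (minAt (s + t) s) = persistProb s * persistProb t * κ.real Set.univ := by
  set tl : (ℕ → ℝ) → ℕ → ℝ := fun y j => y (s + j) with htl
  have hmtl : Measurable tl := measurable_comp_index _
  set B : Set (ℕ → ℝ) := tl ⁻¹' minAt t 0 with hBdef
  have hB : MeasurableSet B := hmtl (measurableSet_minAt t 0)
  have hBc : ∀ y z : ℕ → ℝ, (∀ j, s ≤ j → j < s + t → y j = z j) → (y ∈ B ↔ z ∈ B) :=
    fun y z h => minAt_zero_congr fun j hj => h (s + j) (by omega) (by omega)
  have htail : κ.real B = persistProb t * κ.real Set.univ := by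
    have h := ht ((κ.restrict Set.univ).map tl) inferInstance ?_ ?_ ?_
    · rw [Measure.restrict_univ, map_measureReal_apply hmtl (measurableSet_minAt t 0),
        map_measureReal_apply hmtl MeasurableSet.univ, Set.preimage_univ] at h
      exact h
    · intro σ hσ
      refine MeasurePreserving.map_restrict_of_semiconj (hperm (shiftPerm s σ) ?_)
        MeasurableSet.univ rfl hmtl (measurable_comp_index _) fun y => ?_
      · intro j hj
        obtain ⟨i, rfl⟩ := Nat.exists_eq_add_of_le (show s ≤ j by omega)
        rw [shiftPerm_add, hσ i (by omega)]
      · funext j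
        simp [htl, shiftPerm_add]
    · intro ε hε hε'
      refine MeasurePreserving.map_restrict_of_semiconj
        (hflip (fun j => if j < s then 1 else ε (j - s)) ?_ ?_)
        MeasurableSet.univ rfl hmtl (measurable_flip _) fun y => ?_
      · intro j
        by_cases h : j < s
        · simp [h]
        · simpa [h] using hε _
      · intro j hj
        rw [if_neg (by omega), hε' _ (by omega)]
      · funext j
        simp [htl]
    · rw [Measure.restrict_univ]
      refine tieFree_map hmtl ?_
      filter_upwards [htie] with y hy p q hpq hq
      rw [walk_forward, walk_forward]
      exact fun h => hy (s + p) (s + q) (by omega) (by omega) (by linarith)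
  have hhead : κ.real (minAt (s + t) s) = persistProb s * κ.real B := by
    have h := hs ((κ.restrict B).map (backward s)) inferInstance ?_ ?_ ?_
    · rw [map_measureReal_apply (measurable_backward s) (measurableSet_minAt s 0),
        map_measureReal_apply (measurable_backward s) MeasurableSet.univ, Set.preimage_univ,
        measureReal_restrict_apply (measurable_backward s (measurableSet_minAt s 0)),
        measureReal_restrict_apply MeasurableSet.univ, Set.univ_inter] at h
      rw [← h]
      congr 1
      ext y
      exact mem_minAt_add_iff s t y
    · intro σ hσ
      have hσ' : ∀ j, j < s → σ j < s := fun j hj => by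
        by_contra hc
        have := hσ _ (not_lt.1 hc)
        have := σ.injective this
        omega
      refine MeasurePreserving.map_restrict_of_semiconj
        (hperm ((revPerm s).trans (σ.trans (revPerm s))) ?_) hB ?_ (measurable_backward s)
        (measurable_comp_index _) fun y => ?_
      · intro j hj
        simp [revPerm_of_le (show s ≤ j by omega), hσ j (by omega)]
      · ext y
        rw [Set.mem_preimage]
        refine hBc _ _ fun j hj _ => ?_
        simp [revPerm_of_le hj, hσ j hj]
      · funext j
        simp [backward, revPerm_revPerm]
    · intro ε hε hε'
      refine MeasurePreserving.map_restrict_of_semiconj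
        (hflip (fun j => ε (revPerm s j)) (fun j => hε _) ?_) hB ?_ (measurable_backward s)
        (measurable_flip _) fun y => ?_
      · intro j hj
        rw [revPerm_of_le (by omega), hε' j (by omega)]
      · ext y
        rw [Set.mem_preimage]
        refine hBc _ _ fun j hj _ => ?_
        simp [revPerm_of_le hj, hε' j hj]
      · funext j
        simp [backward, revPerm_revPerm]
    · refine tieFree_map (measurable_backward s) (ae_restrict_of_ae ?_)
      filter_upwards [htie] with y hy p q hpq hq
      rw [walk_backward (by omega), walk_backward hq]
      exact fun h => hy (s - q) (s - p) (by omega) (by omega) (by linarith)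
  rw [hhead, htail, mul_assoc]

/-- **Sparre Andersen's theorem** for sign invariant exchangeable walks. The events that the
minimum sits at time `s` partition the space; for `0 < s < m` they factor into shorter walks, and
those for `s = 0` and `s = m` have equal probability, which leaves one unknown. -/
lemma persistLaw (m : ℕ) : PersistLaw m := by
  induction m using Nat.strong_induction_on with
  | _ m ih =>
  intro κ _ hperm hflip htie
  rcases Nat.eq_zero_or_pos m with rfl | hm
  · have : minAt 0 0 = Set.univ := by
      ext y; simp [minAt]
    rw [this, persistProb_zero, one_mul]
  have hlast : κ.real (minAt m m) = κ.real (minAt m 0) := by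
    have hT := (hflip (fun j => if j < m then -1 else 1)
      (fun j => by by_cases h : j < m <;> simp [h]) (fun j hj => if_neg (by omega))).comp
        (hperm (revPerm m) fun j hj => revPerm_of_le hj)
    rw [← hT.measureReal_preimage (measurableSet_minAt m 0).nullMeasurableSet]
    congr 1
    ext y
    rw [Set.mem_preimage, minAt_zero_congr (z := backward m y) fun j hj => by simp [hj, backward]]
    refine (mem_minAt_add_iff m 0 y).trans (and_iff_left fun k hk hk0 => ?_)
    omega
  have hsum := sum_measureReal_minAt htie
  have hconv := sum_antidiagonal_persistProb m
  rw [Finset.Nat.sum_antidiagonal_eq_sum_range_succ (fun a b => persistProb a * persistProb b)]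
    at hconv
  obtain ⟨m, rfl⟩ := Nat.exists_eq_add_of_le' hm
  rw [Finset.sum_range_succ, Finset.sum_range_succ', hlast] at hsum
  rw [Finset.sum_range_succ, Finset.sum_range_succ'] at hconv
  have hmid : ∑ s ∈ Finset.range m, κ.real (minAt (m + 1) (s + 1))
      = (∑ s ∈ Finset.range m, persistProb (s + 1) * persistProb (m + 1 - (s + 1)))
        * κ.real Set.univ := by
    rw [Finset.sum_mul]
    refine Finset.sum_congr rfl fun s hs => ?_
    rw [Finset.mem_range] at hs
    have hst : m + 1 = s + 1 + (m + 1 - (s + 1)) := by omega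
    have h := measureReal_minAt_of_persistLaw (ih (s + 1) (by omega))
      (ih (m + 1 - (s + 1)) (by omega)) (κ := κ) (by rwa [← hst]) (by rwa [← hst])
      (by rwa [← hst])
    rwa [← hst] at h
  rw [hmid] at hsum
  simp only [Nat.sub_zero, Nat.sub_self, persistProb_zero, one_mul, mul_one] at hconv
  have : ∑ s ∈ Finset.range m, persistProb (s + 1) * persistProb (m + 1 - (s + 1))
      = 1 - 2 * persistProb (m + 1) := by linarith
  rw [this] at hsum
  linarith

/-- The minimum of a sign invariant exchangeable walk of `s + t` steps is attained at time `s`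
with probability `persistProb s * persistProb t`. -/
lemma measureReal_minAt {s t : ℕ} {κ : Measure (ℕ → ℝ)} [IsFiniteMeasure κ]
    (hperm : PermInvariant (s + t) κ) (hflip : FlipInvariant (s + t) κ)
    (htie : TieFree (s + t) κ) :
    κ.real (minAt (s + t) s) = persistProb s * persistProb t * κ.real Set.univ :=
  measureReal_minAt_of_persistLaw (persistLaw s) (persistLaw t) hperm hflip htie

/-! ### The normal functional of a candidate facet -/

/-- The functional `w ↦ det (v_0, …, v_{r-1}, w)` on `ℝ^{r+1}`. It vanishes on the vectors `v_j`,
and if these are linearly independent it is a normal of the hyperplane which they span. -/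
noncomputable def normalForm {r : ℕ} (v : Fin r → EuclideanSpace ℝ (Fin (r + 1))) :
    EuclideanSpace ℝ (Fin (r + 1)) →ₗ[ℝ] ℝ :=
  (EuclideanSpace.basisFun (Fin (r + 1)) ℝ).toBasis.det.toMultilinearMap.toLinearMap
    (Fin.snoc v 0) (Fin.last r)

section NormalForm

variable {r : ℕ} {v : Fin r → EuclideanSpace ℝ (Fin (r + 1))}

lemma normalForm_apply (w : EuclideanSpace ℝ (Fin (r + 1))) :
    normalForm v w = (EuclideanSpace.basisFun (Fin (r + 1)) ℝ).toBasis.det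
      (Fin.snoc v w : Fin (r + 1) → EuclideanSpace ℝ (Fin (r + 1))) := by
  simp [normalForm, Fin.update_snoc_last]

lemma normalForm_self (j : Fin r) : normalForm v (v j) = 0 := by
  rw [normalForm_apply]
  refine AlternatingMap.map_eq_zero_of_eq _ _ (i := j.castSucc) (j := Fin.last r) ?_
    (Fin.castSucc_lt_last j).ne
  simp

lemma span_snoc_eq_top_of_linearIndependent {w : EuclideanSpace ℝ (Fin (r + 1))}
    (h : LinearIndependent ℝ (Fin.snoc v w : Fin (r + 1) → EuclideanSpace ℝ (Fin (r + 1)))) :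
    Submodule.span ℝ (Set.range (Fin.snoc v w : Fin (r + 1) → EuclideanSpace ℝ (Fin (r + 1))))
      = ⊤ :=
  h.span_eq_top_of_card_eq_finrank' (by simp)

lemma normalForm_ne_zero_iff {w : EuclideanSpace ℝ (Fin (r + 1))} :
    normalForm v w ≠ 0 ↔
      LinearIndependent ℝ (Fin.snoc v w : Fin (r + 1) → EuclideanSpace ℝ (Fin (r + 1))) := by
  rw [normalForm_apply, ← isUnit_iff_ne_zero, ← Module.Basis.is_basis_iff_det]
  exact ⟨fun h => h.1, fun h => ⟨h, span_snoc_eq_top_of_linearIndependent h⟩⟩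

lemma normalForm_ne_zero_of_span_eq_top {w : EuclideanSpace ℝ (Fin (r + 1))}
    (h : ∀ l : EuclideanSpace ℝ (Fin (r + 1)) →ₗ[ℝ] ℝ, (∀ j, l (v j) = 0) → l w = 0 → l = 0) :
    normalForm v w ≠ 0 := by
  rw [normalForm_ne_zero_iff]
  refine linearIndependent_of_top_le_span_of_card_eq_finrank ?_ (by simp)
  rw [top_le_iff]
  by_contra hne
  obtain ⟨l, hl, hle⟩ := Submodule.exists_le_ker_of_lt_top _ (lt_top_iff_ne_top.2 hne)
  refine hl (h l (fun j => hle (Submodule.subset_span ⟨j.castSucc, by simp⟩))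
    (hle (Submodule.subset_span ⟨Fin.last r, by simp⟩)))

lemma eq_smul_normalForm {w : EuclideanSpace ℝ (Fin (r + 1))} (hw : normalForm v w ≠ 0)
    {l : EuclideanSpace ℝ (Fin (r + 1)) →ₗ[ℝ] ℝ} (hl : ∀ j, l (v j) = 0) :
    l = (l w / normalForm v w) • normalForm v := by
  refine LinearMap.ext_on_range
    (span_snoc_eq_top_of_linearIndependent (normalForm_ne_zero_iff.1 hw)) fun j => ?_
  refine Fin.lastCases ?_ (fun j => ?_) j
  · simp [hw]
  · simp [hl, normalForm_self]

lemma continuous_normalForm :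
    Continuous fun p : (Fin r → EuclideanSpace ℝ (Fin (r + 1))) ×
      EuclideanSpace ℝ (Fin (r + 1)) => normalForm p.1 p.2 := by
  have hsnoc : Continuous fun p : (Fin r → EuclideanSpace ℝ (Fin (r + 1))) ×
      EuclideanSpace ℝ (Fin (r + 1)) =>
      (Fin.snoc p.1 p.2 : Fin (r + 1) → EuclideanSpace ℝ (Fin (r + 1))) :=
    Continuous.finSnoc continuous_fst continuous_snd
  simp only [normalForm_apply, Module.Basis.det_apply]
  refine Continuous.matrix_det (continuous_matrix fun a b => ?_)
  have h := (EuclideanSpace.proj (𝕜 := ℝ) a).continuous.comp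
    ((continuous_apply b).comp hsnoc)
  refine h.congr fun p => ?_
  simp [Module.Basis.toMatrix_apply]

end NormalForm

-- Unification must not try to unfold the determinant.
attribute [irreducible] normalForm

lemma measurable_normalForm {r : ℕ} {α : Type*} [MeasurableSpace α]
    {v : α → Fin r → EuclideanSpace ℝ (Fin (r + 1))} {w : α → EuclideanSpace ℝ (Fin (r + 1))}
    (hv : Measurable v) (hw : Measurable w) :
    Measurable fun x => normalForm (v x) (w x) := by
  have h1 : Measurable fun x => (v x, w x) := hv.prodMk hw
  have h2 : Measurable fun p : (Fin r → EuclideanSpace ℝ (Fin (r + 1))) ×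
      EuclideanSpace ℝ (Fin (r + 1)) => normalForm p.1 p.2 := by
    apply Continuous.measurable
    exact continuous_normalForm
  exact h2.comp h1



/-! ### Facets of a polytope spanned by points in general position -/

/-- The differences of consecutive points of the subsequence `s (b 0), …, s (b r)`. -/
def edges {V : Type*} [AddCommGroup V] {r : ℕ} (s : ℕ → V) (b : ℕ → ℕ) : Fin r → V :=
  fun j => s (b (j + 1)) - s (b j)

/-- All points among `s 0, …, s n` other than `s (b 0), …, s (b r)` lie strictly on one side,
determined by the sign of `ε`, of the hyperplane through the latter. -/
def OnSide {r : ℕ} (ε : ℝ) (s : ℕ → EuclideanSpace ℝ (Fin (r + 1))) (b : ℕ → ℕ) (n : ℕ) : Prop :=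
  ∀ k ≤ n, (∀ j ≤ r, k ≠ b j) →
    0 < ε * normalForm (edges s b : Fin r → EuclideanSpace ℝ (Fin (r + 1))) (s k - s (b 0))

section Facets

variable {r : ℕ} {s : ℕ → EuclideanSpace ℝ (Fin (r + 1))} {b : ℕ → ℕ}

lemma map_eq_of_map_edges_eq_zero {l : EuclideanSpace ℝ (Fin (r + 1)) →ₗ[ℝ] ℝ}
    (h : ∀ j, l ((edges s b : Fin r → EuclideanSpace ℝ (Fin (r + 1))) j) = 0) {j : ℕ}
    (hj : j ≤ r) : l (s (b j)) = l (s (b 0)) := by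
  induction j with
  | zero => rfl
  | succ j ih =>
    have := h ⟨j, hj⟩
    rw [edges, map_sub, sub_eq_zero] at this
    exact this.trans (ih (by omega))

lemma normalForm_edges_eq {j : ℕ} (hj : j ≤ r) :
    normalForm (edges s b : Fin r → EuclideanSpace ℝ (Fin (r + 1))) (s (b j))
      = normalForm (edges s b : Fin r → EuclideanSpace ℝ (Fin (r + 1))) (s (b 0)) :=
  map_eq_of_map_edges_eq_zero normalForm_self hj

lemma finrank_vectorSpan_convexHull
    (hli : LinearIndependent ℝ (edges s b : Fin r → EuclideanSpace ℝ (Fin (r + 1)))) :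
    Module.finrank ℝ (vectorSpan ℝ (convexHull ℝ ((fun j => s (b j)) '' Set.Iic r))) = r := by
  rw [← direction_affineSpan, affineSpan_convexHull, direction_affineSpan]
  refine le_antisymm ?_ ?_
  · have : (fun j => s (b j)) '' Set.Iic r = Set.range fun j : Fin (r + 1) => s (b j) := by
      ext x
      constructor
      · rintro ⟨j, hj, rfl⟩
        exact ⟨⟨j, Nat.lt_succ_of_le hj⟩, rfl⟩
      · rintro ⟨j, rfl⟩
        exact ⟨j, Nat.le_of_lt_succ j.2, rfl⟩
    rw [this]
    exact finrank_vectorSpan_range_le ℝ _ (by simp)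
  · have h := finrank_span_eq_card hli
    rw [Fintype.card_fin] at h
    refine h.ge.trans (Submodule.finrank_mono (Submodule.span_le.2 ?_))
    rintro _ ⟨j, rfl⟩
    exact vsub_mem_vectorSpan ℝ ⟨j + 1, Nat.succ_le_of_lt j.2, rfl⟩ ⟨j, j.2.le, rfl⟩

/-- In general position, the points `s (b 0), …, s (b r)` span a facet exactly if all the other
points lie on one side of their hyperplane. -/
lemma convexHull_mem_facets_iff {n : ℕ} (hbn : ∀ j ≤ r, b j ≤ n)
    (hgen : ∀ k ≤ n, (∀ j ≤ r, k ≠ b j) →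
      normalForm (edges s b : Fin r → EuclideanSpace ℝ (Fin (r + 1))) (s k - s (b 0)) ≠ 0)
    (hex : ∃ k ≤ n, ∀ j ≤ r, k ≠ b j) :
    convexHull ℝ ((fun j => s (b j)) '' Set.Iic r) ∈ facets (hullUpTo s n)
      ↔ OnSide 1 s b n ∨ OnSide (-1) s b n := by
  set ψ := normalForm (edges s b : Fin r → EuclideanSpace ℝ (Fin (r + 1))) with hψ
  obtain ⟨k₀, hk₀, hk₀b⟩ := hex
  have hA : convexHull ℝ ((fun j => s (b j)) '' Set.Iic r) ⊆ {x | ψ x = ψ (s (b 0))} := by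
    refine convexHull_min ?_ (convex_hyperplane ψ.isLinear _)
    rintro _ ⟨j, hj, rfl⟩
    exact normalForm_edges_eq hj
  have hAC : convexHull ℝ ((fun j => s (b j)) '' Set.Iic r) ⊆ hullUpTo s n := by
    refine convexHull_mono ?_
    rintro _ ⟨j, hj, rfl⟩
    exact ⟨b j, ⟨Nat.zero_le _, hbn j hj⟩, rfl⟩
  have hA0 : s (b 0) ∈ convexHull ℝ ((fun j => s (b j)) '' Set.Iic r) :=
    subset_convexHull ℝ _ ⟨0, Nat.zero_le _, rfl⟩
  have hC : ∀ k ≤ n, s k ∈ hullUpTo s n := fun k hk =>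
    subset_convexHull ℝ _ ⟨k, ⟨Nat.zero_le _, hk⟩, rfl⟩
  constructor
  · rintro ⟨hne, hexp, -⟩
    obtain ⟨l, hl⟩ := hexp hne
    have hconst : ∀ j ≤ r, l (s (b j)) = l (s (b 0)) := fun j hj => by
      have h1 : s (b j) ∈ convexHull ℝ ((fun j => s (b j)) '' Set.Iic r) :=
        subset_convexHull ℝ _ ⟨j, hj, rfl⟩
      have h0 := hA0
      rw [hl] at h1 h0
      exact le_antisymm (h0.2 _ h1.1) (h1.2 _ h0.1)
    have hprop := eq_smul_normalForm (hgen k₀ hk₀ hk₀b) (l := l.toLinearMap)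
      fun j => by
        have h1 := hconst (j + 1) (Nat.succ_le_of_lt j.2)
        have h0 := hconst j j.2.le
        simp [edges, h1, h0]
    set c := l.toLinearMap (s k₀ - s (b 0)) / normalForm
      (edges s b : Fin r → EuclideanSpace ℝ (Fin (r + 1))) (s k₀ - s (b 0))
    have hlc : ∀ x, l x = c * ψ x := fun x => by
      have := LinearMap.congr_fun hprop x
      simpa using this
    -- a maximum of `c * ψ` at `s k` would place `s k` in the hyperplane
    have hlt : ∀ k ≤ n, (∀ j ≤ r, k ≠ b j) → c * ψ (s k) < c * ψ (s (b 0)) := by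
      intro k hk hkb
      rw [← hlc, ← hlc]
      have h0 := hA0
      rw [hl] at h0
      refine lt_of_le_of_ne (h0.2 _ (hC k hk)) fun heq => hgen k hk hkb ?_
      have : s k ∈ convexHull ℝ ((fun j => s (b j)) '' Set.Iic r) := by
        rw [hl]
        exact ⟨hC k hk, fun y hy => heq ▸ h0.2 y hy⟩
      rw [map_sub, sub_eq_zero]
      exact hA this
    have hc : c ≠ 0 := by
      intro hc
      have := hlt k₀ hk₀ hk₀b
      simp [hc] at this
    rcases lt_or_gt_of_ne hc with hc | hc
    · refine Or.inl fun k hk hkb => ?_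
      have := hlt k hk hkb
      rw [one_mul, map_sub]
      nlinarith
    · refine Or.inr fun k hk hkb => ?_
      have := hlt k hk hkb
      rw [map_sub]
      nlinarith
  · intro h
    obtain ⟨ε, hε, h⟩ : ∃ ε : ℝ, ε ≠ 0 ∧ OnSide ε s b n := by
      rcases h with h | h
      exacts [⟨1, one_ne_zero, h⟩, ⟨-1, by norm_num, h⟩]
    have hli : LinearIndependent ℝ (edges s b : Fin r → EuclideanSpace ℝ (Fin (r + 1))) :=
      (linearIndependent_finSnoc.1 (normalForm_ne_zero_iff.1 (hgen k₀ hk₀ hk₀b))).1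
    refine ⟨⟨_, hA0⟩, fun _ => ⟨(-ε) • ψ.toContinuousLinearMap, ?_⟩, ?_⟩
    · set B : Set (EuclideanSpace ℝ (Fin (r + 1))) := s '' {k | k ≤ n ∧ ∀ j ≤ r, k ≠ b j}
      have hB : convexHull ℝ B ⊆ {x | ε * ψ (s (b 0)) < ε * ψ x} := by
        refine convexHull_min ?_ (convex_halfSpace_gt (ε • ψ).isLinear _)
        rintro _ ⟨k, ⟨hk, hkb⟩, rfl⟩
        have := h k hk hkb
        rw [map_sub, mul_sub] at this
        exact sub_pos.1 this
      have hsplit : s '' Set.Icc 0 n = (fun j => s (b j)) '' Set.Iic r ∪ B := by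
        ext x
        constructor
        · rintro ⟨k, ⟨-, hk⟩, rfl⟩
          by_cases hkb : ∀ j ≤ r, k ≠ b j
          · exact Or.inr ⟨k, ⟨hk, hkb⟩, rfl⟩
          · push Not at hkb
            obtain ⟨j, hj, rfl⟩ := hkb
            exact Or.inl ⟨j, hj, rfl⟩
        · rintro (⟨j, hj, rfl⟩ | ⟨k, ⟨hk, -⟩, rfl⟩)
          · exact ⟨b j, ⟨Nat.zero_le _, hbn j hj⟩, rfl⟩
          · exact ⟨k, ⟨Nat.zero_le _, hk⟩, rfl⟩
      have hkey : ∀ x ∈ hullUpTo s n, ε * ψ (s (b 0)) ≤ ε * ψ x ∧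
          (ε * ψ x ≤ ε * ψ (s (b 0)) →
            x ∈ convexHull ℝ ((fun j => s (b j)) '' Set.Iic r)) := by
        intro x hx
        rw [hullUpTo, hsplit, convexHull_union (Set.nonempty_Iic.image _)
          (show B.Nonempty from ⟨_, k₀, ⟨hk₀, hk₀b⟩, rfl⟩), mem_convexJoin] at hx
        obtain ⟨a, ha, e, he, p, q, hp, hq, hpq, rfl⟩ := hx
        have ha' : ψ a = ψ (s (b 0)) := hA ha
        have he' : ε * ψ (s (b 0)) < ε * ψ e := hB he
        have hval : ε * ψ (p • a + q • e)
            = ε * ψ (s (b 0)) + q * (ε * ψ e - ε * ψ (s (b 0))) := by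
          obtain rfl : p = 1 - q := by linarith
          simp [ha']
          ring
        rw [hval]
        have hpos : 0 < ε * ψ e - ε * ψ (s (b 0)) := by linarith
        refine ⟨by nlinarith, fun hle => ?_⟩
        have hq0 : q = 0 := by
          by_contra hne
          have := mul_pos (lt_of_le_of_ne hq (Ne.symm hne)) hpos
          linarith
        obtain rfl : p = 1 := by linarith
        simpa [hq0] using ha
      ext x
      simp only [Set.mem_ofPred_eq, _root_.smul_apply,
        LinearMap.coe_toContinuousLinearMap', smul_eq_mul]
      constructor
      · intro hx
        refine ⟨hAC hx, fun y hy => ?_⟩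
        have h1 := (hkey y hy).1
        have h2 : ψ x = ψ (s (b 0)) := hA hx
        rw [h2]
        linarith
      · rintro ⟨hx, hmax⟩
        have := hmax _ (hAC hA0)
        exact (hkey x hx).2 (by linarith)
    · rw [finrank_vectorSpan_convexHull hli]

end Facets

/-! ### Genericity of exchangeable walks in general position -/

lemma walk_comp_perm {V : Type*} [AddCommMonoid V] (x : ℕ → V) (σ : Equiv.Perm ℕ) {k : ℕ}
    (h : ∀ j, j < k ↔ σ j < k) : walk (x ∘ σ) k = walk x k :=
  Finset.sum_equiv σ (fun j => by simpa using h j) fun _ _ => rfl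

lemma walk_sub_walk {V : Type*} [AddCommGroup V] (x : ℕ → V) {p q : ℕ} (h : p ≤ q) :
    walk x q - walk x p = ∑ j ∈ Finset.Ico p q, x j :=
  (Finset.sum_Ico_eq_sub x h).symm

/-- A permutation of the first `n` indices, extended to all natural numbers. -/
def extendPerm {n : ℕ} (σ : Equiv.Perm (Fin n)) : Equiv.Perm ℕ :=
  σ.extendDomain Fin.equivSubtype

lemma extendPerm_val {n : ℕ} (σ : Equiv.Perm (Fin n)) (j : Fin n) :
    extendPerm σ j = (σ j : ℕ) :=
  Equiv.Perm.extendDomain_apply_image σ Fin.equivSubtype j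

lemma extendPerm_of_le {n : ℕ} (σ : Equiv.Perm (Fin n)) {j : ℕ} (hj : n ≤ j) :
    extendPerm σ j = j :=
  Equiv.Perm.extendDomain_apply_not_subtype σ Fin.equivSubtype (by omega)

lemma perm_lt_iff {n : ℕ} {σ : Equiv.Perm ℕ} (hσ : ∀ j, n ≤ j → σ j = j) (j : ℕ) :
    j < n ↔ σ j < n := by
  constructor
  · intro h
    by_contra hc
    have := σ.injective (hσ _ (not_lt.1 hc))
    omega
  · intro h
    by_contra hc
    rw [hσ j (not_lt.1 hc)] at h
    exact hc h

lemma eq_range_card_of_lower {s : Finset ℕ} (h : ∀ j ∈ s, ∀ i ≤ j, i ∈ s) :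
    s = Finset.range s.card := by
  refine Finset.eq_of_subset_of_card_le (fun j hj => ?_) (by simp)
  have : Finset.range (j + 1) ⊆ s := fun i hi =>
    h j hj i (Nat.le_of_lt_succ (Finset.mem_range.1 hi))
  have := Finset.card_le_card this
  rw [Finset.card_range] at this
  exact Finset.mem_range.2 this

lemma monotoneOn_of_step {r : ℕ} {b : ℕ → ℕ} (hb : ∀ j < r, b j < b (j + 1)) {i j : ℕ} (hij : i ≤ j)
    (hj : j ≤ r) : b i ≤ b j := by
  induction j, hij using Nat.le_induction with
  | base => exact le_rfl
  | succ j _ ih => exact (ih (by omega)).trans (hb j (by omega)).le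

section Generic

variable {r n : ℕ} {ν : Measure (ℕ → EuclideanSpace ℝ (Fin (r + 1)))}

/-- The sums of the increments over `r + 1` disjoint nonempty classes of indices (the classes being
the level sets of `f`) almost surely span the space. Sorting the indices by their class turns the
sums over the first `a` classes into values of the walk, which are in general position. -/
lemma ae_eq_zero_of_map_class_sum_eq_zero (hperm : PermInvariant n ν)
    (hgp : ∀ᵐ x ∂ν, InGeneralPosition (walk x) n) (f : ℕ → ℕ)
    (hf : ∀ a ≤ r, ∃ j < n, f j = a) :
    ∀ᵐ x ∂ν, ∀ l : EuclideanSpace ℝ (Fin (r + 1)) →ₗ[ℝ] ℝ,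
      (∀ a ≤ r, l (∑ j ∈ Finset.range n with f j = a, x j) = 0) → l = 0 := by
  set σ : Equiv.Perm (Fin n) := Tuple.sort fun j : Fin n => f j
  have hmono : Monotone ((fun j : Fin n => f j) ∘ σ) := Tuple.monotone_sort _
  set τ := extendPerm σ with hτ
  have hτn : ∀ j, n ≤ j → τ j = j := fun j hj => extendPerm_of_le σ hj
  have hmono' : ∀ i j, i ≤ j → j < n → f (τ i) ≤ f (τ j) := by
    intro i j hij hj
    have := hmono (show (⟨i, by omega⟩ : Fin n) ≤ ⟨j, hj⟩ from hij)
    have hi' := extendPerm_val σ ⟨i, by omega⟩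
    have hj' := extendPerm_val σ ⟨j, hj⟩
    simp only [Function.comp] at this
    rw [← hi', ← hj'] at this
    exact this
  set c : ℕ → ℕ := fun a => ((Finset.range n).filter fun j => f j ≤ a).card with hc
  have hcard : ∀ a, ((Finset.range n).filter fun j => f (τ j) ≤ a) = Finset.range (c a) := by
    intro a
    have h1 : ((Finset.range n).filter fun j => f (τ j) ≤ a).card = c a := by
      refine Finset.card_equiv τ fun j => ?_
      simp only [Finset.mem_filter, Finset.mem_range]
      rw [← perm_lt_iff hτn]
    rw [← h1]
    refine eq_range_card_of_lower fun j hj i hij => ?_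
    simp only [Finset.mem_filter, Finset.mem_range] at hj ⊢
    exact ⟨by omega, (hmono' i j hij hj.1).trans hj.2⟩
  have hwalk : ∀ (x : ℕ → EuclideanSpace ℝ (Fin (r + 1))) a,
      walk (x ∘ τ) (c a) = ∑ j ∈ Finset.range n with f j ≤ a, x j := by
    intro x a
    rw [walk, ← hcard]
    refine Finset.sum_equiv τ (fun j => ?_) fun _ _ => rfl
    simp only [Finset.mem_filter, Finset.mem_range]
    rw [← perm_lt_iff hτn]
  have hcmono : ∀ a a', a < a' → a' ≤ r → c a < c a' := by
    intro a a' h h'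
    refine Finset.card_lt_card (Finset.ssubset_iff_subset_ne.2 ⟨fun j hj => ?_, fun heq => ?_⟩)
    · simp only [Finset.mem_filter] at hj ⊢
      exact ⟨hj.1, by omega⟩
    · obtain ⟨j, hj, hfj⟩ := hf a' h'
      have : j ∈ (Finset.range n).filter fun j => f j ≤ a' := by simp [hj, hfj]
      rw [← heq] at this
      simp [hfj] at this
      omega
  filter_upwards [(hperm τ hτn).quasiMeasurePreserving.ae hgp] with x hx l hl
  have hli := hx (fun a : Fin (r + 1) => c a) ?_ ?_
  · have hspan := hli.span_eq_top_of_card_eq_finrank' (by simp)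
    have hcum : ∀ a ≤ r, l (walk (x ∘ τ) (c a)) = 0 := by
      intro a ha
      rw [hwalk]
      induction a with
      | zero => simpa using hl 0 ha
      | succ a ih =>
        have : ((Finset.range n).filter fun j => f j ≤ a + 1)
            = ((Finset.range n).filter fun j => f j ≤ a) ∪
              ((Finset.range n).filter fun j => f j = a + 1) := by
          ext j
          simp only [Finset.mem_filter, Finset.mem_union, Finset.mem_range]
          omega
        rw [this, Finset.sum_union, map_add, ih (by omega), hl _ ha, add_zero]
        refine Finset.disjoint_filter.2 fun j _ h1 h2 => ?_
        omega
    refine LinearMap.ext_on_range hspan fun a => ?_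
    rw [LinearMap.zero_apply]
    exact hcum a (Nat.le_of_lt_succ a.2)
  · intro a a' h
    by_contra hne
    rcases lt_or_gt_of_ne hne with hlt | hlt
    · exact (hcmono a a' hlt (Nat.le_of_lt_succ a'.2)).ne h
    · exact (hcmono a' a hlt (Nat.le_of_lt_succ a.2)).ne h.symm
  · intro a
    obtain ⟨j, hj, hfj⟩ := hf 0 (Nat.zero_le _)
    refine ⟨Finset.card_pos.2 ⟨j, by simp [hj, hfj]⟩, ?_⟩
    exact (Finset.card_filter_le _ _).trans (by simp)

/-- The normal functional of the points `walk x (b 0), …, walk x (b r)` almost surely separates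
the times `p < q`, provided that `[p, q)` is disjoint from each block `[b j, b (j + 1))` or a
proper part of it. -/
lemma ae_normalForm_ne_zero (hperm : PermInvariant n ν)
    (hgp : ∀ᵐ x ∂ν, InGeneralPosition (walk x) n) {b : ℕ → ℕ} (hb : ∀ j < r, b j < b (j + 1))
    (hbn : b r ≤ n) {p q : ℕ} (hpq : p < q) (hq : q ≤ n)
    (h : ∀ j < r, (q ≤ b j ∨ b (j + 1) ≤ p) ∨
      (b j ≤ p ∧ q ≤ b (j + 1) ∧ (b j < p ∨ q < b (j + 1)))) :
    ∀ᵐ x ∂ν, normalForm (edges (walk x) b : Fin r → EuclideanSpace ℝ (Fin (r + 1)))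
      (walk x q - walk x p) ≠ 0 := by
  classical
  have hmono : ∀ i j, i ≤ j → j ≤ r → b i ≤ b j := fun i j hij hj => monotoneOn_of_step hb hij hj
  set f : ℕ → ℕ := fun i => if p ≤ i ∧ i < q then r else
    if h : ∃ j < r, b j ≤ i ∧ i < b (j + 1) then h.choose else r + 1 with hfdef
  have hfr : ∀ i, f i = r ↔ p ≤ i ∧ i < q := by
    intro i
    by_cases h1 : p ≤ i ∧ i < q
    · simp [hfdef, h1]
    · by_cases h2 : ∃ j < r, b j ≤ i ∧ i < b (j + 1)
      · have := h2.choose_spec.1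
        simp only [hfdef, h1, h2, if_false, dif_pos]
        simp
        omega
      · simp only [hfdef, h1, h2, if_false]
        simp
  have hfj : ∀ i, ∀ j < r, f i = j ↔ (b j ≤ i ∧ i < b (j + 1)) ∧ ¬ (p ≤ i ∧ i < q) := by
    intro i j hj
    by_cases h1 : p ≤ i ∧ i < q
    · simp only [hfdef, h1]
      simp
      omega
    · by_cases h2 : ∃ j < r, b j ≤ i ∧ i < b (j + 1)
      · have hspec := h2.choose_spec
        set j' := h2.choose
        have : f i = j' := by simp only [hfdef, h1, h2, if_false, dif_pos]; rfl
        rw [this]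
        constructor
        · rintro rfl
          exact ⟨hspec.2, h1⟩
        · rintro ⟨h3, -⟩
          by_contra hne
          rcases lt_or_gt_of_ne hne with hlt | hlt
          · have := hmono (j' + 1) j hlt hj.le
            omega
          · have := hmono (j + 1) j' hlt hspec.1.le
            omega
      · have : f i = r + 1 := by simp only [hfdef, h1, h2, if_false]; simp
        rw [this]
        constructor
        · omega
        · rintro ⟨h3, -⟩
          exact absurd ⟨j, hj, h3⟩ h2
  have hbr : ∀ j < r, b (j + 1) ≤ n := fun j hj => (hmono (j + 1) r hj le_rfl).trans hbn
  have hhit : ∀ a ≤ r, ∃ j < n, f j = a := by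
    intro a ha
    rcases ha.lt_or_eq with ha | rfl
    · have := hb a ha
      have := hbr a ha
      rcases h a ha with h1 | ⟨h1, h2, h3 | h3⟩
      · exact ⟨b a, by omega, (hfj _ a ha).2 ⟨by omega, by omega⟩⟩
      · exact ⟨b a, by omega, (hfj _ a ha).2 ⟨by omega, by omega⟩⟩
      · exact ⟨q, by omega, (hfj _ a ha).2 ⟨by omega, by omega⟩⟩
    · exact ⟨p, by omega, (hfr p).2 ⟨le_rfl, hpq⟩⟩
  filter_upwards [ae_eq_zero_of_map_class_sum_eq_zero hperm hgp f hhit] with x hx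
  refine normalForm_ne_zero_of_span_eq_top fun l hl hlw => hx l fun a ha => ?_
  rw [walk_sub_walk x hpq.le] at hlw
  rcases ha.lt_or_eq with ha | rfl
  · have hla := hl ⟨a, ha⟩
    rw [edges, walk_sub_walk x (hb a ha).le] at hla
    have hset : ((Finset.range n).filter fun j => f j = a)
        = Finset.Ico (b a) (b (a + 1)) \ Finset.Ico p q := by
      ext i
      have := hbr a ha
      simp only [Finset.mem_filter, Finset.mem_range, Finset.mem_sdiff, Finset.mem_Ico,
        hfj i a ha]
      omega
    rw [hset]
    rcases h a ha with h1 | ⟨h1, h2, -⟩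
    · rw [Finset.sdiff_eq_self_of_disjoint]
      · exact hla
      · rw [Finset.disjoint_left]
        intro i hi hi'
        simp only [Finset.mem_Ico] at hi hi'
        omega
    · have := Finset.sum_sdiff (f := x) (Finset.Ico_subset_Ico h1 h2)
      rw [← this, map_add, hlw, add_zero] at hla
      exact hla
  · have hset : ((Finset.range n).filter fun j => f j = a) = Finset.Ico p q := by
      ext i
      simp only [Finset.mem_filter, Finset.mem_range, Finset.mem_Ico, hfr i]
      omega
    rw [hset]
    exact hlw

end Generic

/-! ### Measurability of the events -/

section Measurability

variable {r : ℕ}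

lemma measurable_edges_walk (b : ℕ → ℕ) : Measurable fun x : ℕ → EuclideanSpace ℝ (Fin (r + 1)) =>
    (edges (walk x) b : Fin r → EuclideanSpace ℝ (Fin (r + 1))) :=
  measurable_pi_lambda _ fun _ => (measurable_walk _).sub (measurable_walk _)

lemma measurable_normalForm_walk (b : ℕ → ℕ) {w : (ℕ → EuclideanSpace ℝ (Fin (r + 1))) →
    EuclideanSpace ℝ (Fin (r + 1))} (hw : Measurable w) :
    Measurable fun x : ℕ → EuclideanSpace ℝ (Fin (r + 1)) =>
      normalForm (edges (walk x) b : Fin r → EuclideanSpace ℝ (Fin (r + 1))) (w x) :=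
  measurable_normalForm (measurable_edges_walk b) hw

lemma measurableSet_onSide (ε : ℝ) (b : ℕ → ℕ) (n : ℕ) :
    MeasurableSet {x : ℕ → EuclideanSpace ℝ (Fin (r + 1)) | OnSide ε (walk x) b n} := by
  simp only [OnSide, Set.ofPred_forall]
  exact MeasurableSet.iInter fun k => MeasurableSet.iInter fun _ => MeasurableSet.iInter fun _ =>
    measurableSet_lt measurable_const ((measurable_normalForm_walk b
      ((measurable_walk k).sub (measurable_walk (b 0)))).const_mul ε)

end Measurability

/-- In general position, the probability that the points at the times `b 0 < ⋯ < b r` span a facet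
splits according to the side of the facet on which the hull lies. -/
lemma measureReal_facet {r n : ℕ} {ν : Measure (ℕ → EuclideanSpace ℝ (Fin (r + 1)))}
    [IsFiniteMeasure ν] (hrn : r + 1 ≤ n) (hperm : PermInvariant n ν)
    (hgp : ∀ᵐ x ∂ν, InGeneralPosition (walk x) n) {b : ℕ → ℕ} (hb : ∀ j < r, b j < b (j + 1))
    (hbn : b r ≤ n) {F : Set (ℕ → EuclideanSpace ℝ (Fin (r + 1)))}
    (hF : ∀ x, x ∈ F ↔ convexHull ℝ ((fun j => walk x (b j)) '' Set.Iic r)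
      ∈ facets (hullUpTo (walk x) n)) :
    ∃ F' : Set (ℕ → EuclideanSpace ℝ (Fin (r + 1))), MeasurableSet F' ∧ F =ᵐ[ν] F' ∧
      ν.real F' = ν.real {x | OnSide 1 (walk x) b n} + ν.real {x | OnSide (-1) (walk x) b n} := by
  have hmono : ∀ i j, i ≤ j → j ≤ r → b i ≤ b j := fun i j hij hj => monotoneOn_of_step hb hij hj
  have hex : ∃ k ≤ n, ∀ j ≤ r, k ≠ b j := by
    by_contra! hcon
    have hsub : Finset.range (n + 1) ⊆ (Finset.range (r + 1)).image b := fun k hk => by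
      obtain ⟨j, hj, rfl⟩ := hcon k (Nat.le_of_lt_succ (Finset.mem_range.1 hk))
      exact Finset.mem_image_of_mem b (Finset.mem_range.2 (by omega))
    have := (Finset.card_le_card hsub).trans Finset.card_image_le
    simp only [Finset.card_range] at this
    omega
  have hgen : ∀ᵐ x ∂ν, ∀ k ≤ n, (∀ j ≤ r, k ≠ b j) →
      normalForm (edges (walk x) b : Fin r → EuclideanSpace ℝ (Fin (r + 1)))
        (walk x k - walk x (b 0)) ≠ 0 := by
    rw [ae_all_iff]
    intro k
    by_cases hk : k ≤ n ∧ ∀ j ≤ r, k ≠ b j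
    swap
    · exact Filter.Eventually.of_forall fun x h1 h2 => absurd ⟨h1, h2⟩ hk
    obtain ⟨hk, hkb⟩ := hk
    rcases lt_or_ge k (b 0) with hlt | hge
    · have h0r := hmono 0 r (Nat.zero_le r) le_rfl
      filter_upwards [ae_normalForm_ne_zero hperm hgp hb hbn hlt (by omega)
        fun j hj => Or.inl (Or.inl (hmono 0 j (by omega) hj.le))] with x hx _ _
      rw [← neg_sub, map_neg]
      exact neg_ne_zero.2 hx
    · -- the last time `b j ≤ k`
      have hlast : ∃ j ≤ r, b j < k ∧ (∀ i ≤ r, b i < k → i ≤ j) := by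
        have hb0 : b 0 < k := lt_of_le_of_ne hge (hkb 0 (Nat.zero_le _)).symm
        refine ⟨Nat.findGreatest (fun j => b j < k) r, Nat.findGreatest_le r,
          Nat.findGreatest_spec (P := fun j => b j < k) (Nat.zero_le r) hb0,
          fun i hi hik => Nat.le_findGreatest hi hik⟩
      obtain ⟨j, hj, hjk, hjmax⟩ := hlast
      filter_upwards [ae_normalForm_ne_zero hperm hgp hb hbn hjk hk fun i hi => by
        rcases lt_trichotomy i j with hij | rfl | hij
        · exact Or.inl (Or.inr (hmono (i + 1) j hij hj))
        · refine Or.inr ⟨le_rfl, ?_, Or.inr ?_⟩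
          all_goals
            have := hkb (i + 1) hi
            have := mt (hjmax (i + 1) hi) (by omega)
            omega
        · have := mt (hjmax i hi.le) (by omega)
          exact Or.inl (Or.inl (by omega))] with x hx _ _
      rw [map_sub, ← normalForm_edges_eq hj, ← map_sub]
      exact hx
  refine ⟨{x | OnSide 1 (walk x) b n} ∪ {x | OnSide (-1) (walk x) b n},
    (measurableSet_onSide 1 b n).union (measurableSet_onSide (-1) b n), ?_, ?_⟩
  · filter_upwards [hgen] with x hx
    refine propext ((hF x).trans ?_)
    exact convexHull_mem_facets_iff (fun j hj => (hmono j r hj le_rfl).trans hbn) hx hex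
  · refine measureReal_union (Set.disjoint_left.2 fun x h1 h2 => ?_) (measurableSet_onSide (-1) b n)
    obtain ⟨k, hk, hkb⟩ := hex
    have h1' := h1 k hk hkb
    have h2' := h2 k hk hkb
    linarith

/-! ### Cyclic shifts of the blocks -/

/-- The cyclic shift by `c` of the block `[a, a + ℓ)`. -/
def rotPerm (a ℓ c : ℕ) (hc : c ≤ ℓ) : Equiv.Perm ℕ where
  toFun j := if a ≤ j ∧ j < a + ℓ then (if j + c < a + ℓ then j + c else j + c - ℓ) else j
  invFun j := if a ≤ j ∧ j < a + ℓ then (if a + c ≤ j then j - c else j + ℓ - c) else j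
  left_inv j := by dsimp only; split_ifs <;> omega
  right_inv j := by dsimp only; split_ifs <;> omega

lemma rotPerm_apply {a ℓ c : ℕ} (hc : c ≤ ℓ) (j : ℕ) : rotPerm a ℓ c hc j =
    if a ≤ j ∧ j < a + ℓ then (if j + c < a + ℓ then j + c else j + c - ℓ) else j := rfl

lemma walk_comp_rotPerm_of_outside {V : Type*} [AddCommMonoid V] (x : ℕ → V) {a ℓ c k : ℕ}
    (hc : c ≤ ℓ) (hk : k ≤ a ∨ a + ℓ ≤ k) : walk (x ∘ rotPerm a ℓ c hc) k = walk x k := by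
  refine walk_comp_perm x _ fun j => ?_
  rw [rotPerm_apply]
  split_ifs <;> omega

lemma walk_comp_rotPerm {V : Type*} [AddCommGroup V] (x : ℕ → V) {a ℓ c t : ℕ} (hc : c ≤ ℓ)
    (ht : t ≤ ℓ) : walk (x ∘ rotPerm a ℓ c hc) (a + t) = walk x a - walk x (a + c) +
      if c + t ≤ ℓ then walk x (a + c + t)
      else walk x (a + ℓ) - walk x a + walk x (a + c + t - ℓ) := by
  induction t with
  | zero => simp [hc, walk_comp_rotPerm_of_outside x hc (Or.inl le_rfl)]
  | succ t ih =>
    have hidx : rotPerm a ℓ c hc (a + t) = if c + t < ℓ then a + c + t else a + c + t - ℓ := by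
      rw [rotPerm_apply]
      split_ifs <;> omega
    rw [← add_assoc, walk_succ, ih (by omega), Function.comp, hidx]
    rcases lt_trichotomy (c + t) ℓ with h | h | h
    · rw [if_pos h.le, if_pos h, if_pos (by omega), ← add_assoc, walk_succ]
      abel
    · rw [if_pos h.le, if_neg h.not_lt, if_neg (by omega),
        show a + c + (t + 1) - ℓ = a + c + t - ℓ + 1 by omega, walk_succ,
        show a + c + t = a + ℓ by omega, Nat.add_sub_cancel]
      abel
    · rw [if_neg h.not_ge, if_neg h.not_gt, if_neg (by omega),
        show a + c + (t + 1) - ℓ = a + c + t - ℓ + 1 by omega, walk_succ]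
      abel

section Blocks

variable {r : ℕ}

/-- During the block `(b j, b (j + 1))` the walk stays strictly on the side `ε` of the hyperplane
through its values at the times `b 0, …, b r`. -/
def blockOnSide (r : ℕ) (ε : ℝ) (b : ℕ → ℕ) (j : ℕ) :
    Set (ℕ → EuclideanSpace ℝ (Fin (r + 1))) :=
  {x | ∀ k, b j < k → k < b (j + 1) → 0 < ε * normalForm
    (edges (walk x) b : Fin r → EuclideanSpace ℝ (Fin (r + 1))) (walk x k - walk x (b j))}

lemma measurableSet_blockOnSide (ε : ℝ) (b : ℕ → ℕ) (j : ℕ) :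
    MeasurableSet (blockOnSide r ε b j) := by
  simp only [blockOnSide, Set.ofPred_forall]
  exact MeasurableSet.iInter fun k => MeasurableSet.iInter fun _ => MeasurableSet.iInter fun _ =>
    measurableSet_lt measurable_const ((measurable_normalForm_walk b
      ((measurable_walk k).sub (measurable_walk (b j)))).const_mul ε)

lemma outside_block {b : ℕ → ℕ} (hb : ∀ j < r, b j < b (j + 1)) {i j : ℕ} (hi : i ≤ r)
    (hj : j < r) : b i ≤ b j ∨ b (j + 1) ≤ b i := by
  rcases le_or_gt i j with h | h
  · exact Or.inl (monotoneOn_of_step hb h hj.le)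
  · exact Or.inr (monotoneOn_of_step hb h hi)

/-- Cyclic shifts within the block `[b j, b (j + 1))`. -/
def blockRot (b : ℕ → ℕ) (j c : ℕ) (hc : c ≤ b (j + 1) - b j) : Equiv.Perm ℕ :=
  rotPerm (b j) (b (j + 1) - b j) c hc

lemma walk_comp_blockRot {V : Type*} [AddCommMonoid V] (x : ℕ → V) {b : ℕ → ℕ} {j c k : ℕ}
    (hbj : b j < b (j + 1)) (hc : c ≤ b (j + 1) - b j) (hk : k ≤ b j ∨ b (j + 1) ≤ k) :
    walk (x ∘ blockRot b j c hc) k = walk x k :=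
  walk_comp_rotPerm_of_outside x hc (by omega)

lemma edges_comp_blockRot (x : ℕ → EuclideanSpace ℝ (Fin (r + 1))) {b : ℕ → ℕ}
    (hb : ∀ j < r, b j < b (j + 1)) {j c : ℕ} (hj : j < r) (hc : c ≤ b (j + 1) - b j) :
    (edges (walk (x ∘ blockRot b j c hc)) b : Fin r → EuclideanSpace ℝ (Fin (r + 1)))
      = edges (walk x) b := by
  funext i
  rw [edges, edges, walk_comp_blockRot x (hb j hj) hc (outside_block hb i.2 hj),
    walk_comp_blockRot x (hb j hj) hc (outside_block hb i.2.le hj)]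

lemma mem_blockOnSide_comp_blockRot_of_ne (ε : ℝ) (x : ℕ → EuclideanSpace ℝ (Fin (r + 1)))
    {b : ℕ → ℕ} (hb : ∀ j < r, b j < b (j + 1)) {i j c : ℕ} (hi : i < r) (hj : j < r)
    (hij : i ≠ j) (hc : c ≤ b (j + 1) - b j) :
    x ∘ blockRot b j c hc ∈ blockOnSide r ε b i ↔ x ∈ blockOnSide r ε b i := by
  refine forall_congr' fun k => forall₂_congr fun h1 h2 => ?_
  rw [edges_comp_blockRot x hb hj hc,
    walk_comp_blockRot x (hb j hj) hc (outside_block hb hi.le hj),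
    walk_comp_blockRot x (hb j hj) hc]
  rcases lt_or_gt_of_ne hij with h | h
  · exact Or.inl (h2.le.trans (monotoneOn_of_step hb h hj.le))
  · exact Or.inr ((monotoneOn_of_step hb h hi.le).trans h1.le)

/-- A cyclic shift of the block puts it on the side `ε` exactly if it starts at the time when the
height of the walk over the hyperplane is minimal. -/
lemma mem_blockOnSide_comp_blockRot_iff (ε : ℝ) (x : ℕ → EuclideanSpace ℝ (Fin (r + 1)))
    {b : ℕ → ℕ} (hb : ∀ j < r, b j < b (j + 1)) {j c : ℕ} (hj : j < r)
    (hc : c < b (j + 1) - b j) :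
    x ∘ blockRot b j c hc.le ∈ blockOnSide r ε b j ↔
      ∀ k ≤ b (j + 1) - b j - 1, k ≠ c →
        ε * normalForm (edges (walk x) b : Fin r → EuclideanSpace ℝ (Fin (r + 1)))
            (walk x (b j + c))
          < ε * normalForm (edges (walk x) b : Fin r → EuclideanSpace ℝ (Fin (r + 1)))
            (walk x (b j + k)) := by
  set ψ := normalForm (edges (walk x) b : Fin r → EuclideanSpace ℝ (Fin (r + 1))) with hψ
  set ℓ := b (j + 1) - b j with hℓ
  have hbj := hb j hj
  have hend : ψ (walk x (b j + ℓ)) = ψ (walk x (b j)) := by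
    rw [show b j + ℓ = b (j + 1) by omega]
    exact (normalForm_edges_eq (s := walk x) hj).trans
      (normalForm_edges_eq (s := walk x) hj.le).symm
  have hval : ∀ t ≤ ℓ, ψ (walk (x ∘ rotPerm (b j) ℓ c hc.le) (b j + t) - walk x (b j))
      = (if c + t ≤ ℓ then ψ (walk x (b j + (c + t))) else ψ (walk x (b j + (c + t - ℓ))))
        - ψ (walk x (b j + c)) := by
    intro t ht
    rw [walk_comp_rotPerm x hc.le ht]
    split_ifs with h
    · simp only [map_sub, map_add, add_assoc]
      ring
    · rw [show b j + c + t - ℓ = b j + (c + t - ℓ) by omega]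
      simp only [map_sub, map_add, hend]
      ring
  rw [blockOnSide, Set.mem_ofPred_eq, edges_comp_blockRot x hb hj hc.le,
    walk_comp_blockRot x hbj hc.le (Or.inl le_rfl), ← hψ, blockRot]
  constructor
  · intro h k hk hkc
    rcases lt_or_gt_of_ne hkc with hlt | hlt
    · have := h (b j + (k + ℓ - c)) (by omega) (by omega)
      rcases Nat.eq_zero_or_pos k with rfl | hk0
      · rw [hval _ (by omega), if_pos (by omega), show c + (0 + ℓ - c) = ℓ by omega, hend] at this
        rw [Nat.add_zero (b j)]
        linarith
      · rw [hval _ (by omega), if_neg (by omega), show c + (k + ℓ - c) - ℓ = k by omega] at this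
        linarith
    · have := h (b j + (k - c)) (by omega) (by omega)
      rw [hval _ (by omega), if_pos (by omega), show c + (k - c) = k by omega] at this
      linarith
  · intro h k h1 h2
    obtain ⟨t, rfl⟩ := Nat.exists_eq_add_of_lt h1
    rw [add_assoc, hval _ (by omega), mul_sub, sub_pos]
    split_ifs with hct
    · rcases Nat.lt_or_ge (c + (t + 1)) ℓ with hlt | hge
      · exact h _ (by omega) (by omega)
      · rw [show c + (t + 1) = ℓ by omega, hend]
        exact h 0 (by omega) (by omega)
    · exact h _ (by omega) (by omega)

/-- Each block lies on the side `ε` with conditional probability the inverse of its length, given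
the other blocks and any event `Y` insensitive to cyclic shifts of the blocks. -/
lemma measureReal_inter_blockOnSide {n : ℕ} {ν : Measure (ℕ → EuclideanSpace ℝ (Fin (r + 1)))}
    [IsFiniteMeasure ν] (hperm : PermInvariant n ν)
    (hgp : ∀ᵐ x ∂ν, InGeneralPosition (walk x) n) {ε : ℝ} (hε : ε ≠ 0) {b : ℕ → ℕ}
    (hb : ∀ j < r, b j < b (j + 1)) (hbn : b r ≤ n)
    {Y : Set (ℕ → EuclideanSpace ℝ (Fin (r + 1)))} (hY : MeasurableSet Y)
    (hYrot : ∀ j < r, ∀ c (hc : c ≤ b (j + 1) - b j) x, x ∘ blockRot b j c hc ∈ Y ↔ x ∈ Y)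
    (J : Finset ℕ) (hJ : ∀ j ∈ J, j < r) :
    ν.real {x | x ∈ Y ∧ ∀ j ∈ J, x ∈ blockOnSide r ε b j}
      * ∏ j ∈ J, ((b (j + 1) : ℝ) - b j) = ν.real Y := by
  induction J using Finset.induction_on with
  | empty => simp
  | insert j J hjJ ih =>
    have hj : j < r := hJ j (Finset.mem_insert_self j J)
    have hJ' : ∀ i ∈ J, i < r := fun i hi => hJ i (Finset.mem_insert_of_mem hi)
    have hbj := hb j hj
    have hbjn : b (j + 1) ≤ n := (monotoneOn_of_step hb hj le_rfl).trans hbn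
    set G : Set (ℕ → EuclideanSpace ℝ (Fin (r + 1))) :=
      {x | x ∈ Y ∧ ∀ i ∈ J, x ∈ blockOnSide r ε b i} with hG
    set W := blockOnSide r ε b j with hW
    have hGm : MeasurableSet G := by
      rw [hG, Set.ofPred_and]
      refine hY.inter ?_
      simp only [Set.ofPred_forall]
      exact MeasurableSet.iInter fun i => MeasurableSet.iInter fun _ =>
        measurableSet_blockOnSide ε b i
    have hGrot : ∀ c (hc : c ≤ b (j + 1) - b j) x, x ∘ blockRot b j c hc ∈ G ↔ x ∈ G := by
      intro c hc x
      refine and_congr (hYrot j hj c hc x) (forall₂_congr fun i hi => ?_)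
      exact mem_blockOnSide_comp_blockRot_of_ne ε x hb (hJ' i hi) hj
        (fun h => hjJ (h ▸ hi)) hc
    have hset : {x | x ∈ Y ∧ ∀ i ∈ insert j J, x ∈ blockOnSide r ε b i} = G ∩ W := by
      ext x
      simp only [Finset.forall_mem_insert, Set.mem_ofPred_eq, Set.mem_inter_iff, hG]
      tauto
    have hsum : ∑ c ∈ Finset.range (b (j + 1) - b j - 1 + 1), ν.real
        {x | x ∈ G ∧ ∀ k ≤ b (j + 1) - b j - 1, k ≠ c →
          ε * normalForm (edges (walk x) b : Fin r → EuclideanSpace ℝ (Fin (r + 1)))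
              (walk x (b j + c))
            < ε * normalForm (edges (walk x) b : Fin r → EuclideanSpace ℝ (Fin (r + 1)))
              (walk x (b j + k))} = ν.real G := by
      refine sum_measureReal_of_existsUnique (fun c _ => ?_) (fun c _ x hx => hx.1) ?_
      · rw [Set.ofPred_and]
        refine hGm.inter ?_
        simp only [Set.ofPred_forall]
        exact MeasurableSet.iInter fun k => MeasurableSet.iInter fun _ =>
          MeasurableSet.iInter fun _ => measurableSet_lt
            ((measurable_normalForm_walk b (measurable_walk _)).const_mul ε)
            ((measurable_normalForm_walk b (measurable_walk _)).const_mul ε)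
      · have hne : ∀ᵐ x ∂ν, ∀ p q, p < q → q ≤ b (j + 1) - b j - 1 →
            normalForm (edges (walk x) b : Fin r → EuclideanSpace ℝ (Fin (r + 1)))
              (walk x (b j + q) - walk x (b j + p)) ≠ 0 := by
          simp only [ae_all_iff]
          intro p q hpq hq
          refine ae_normalForm_ne_zero hperm hgp hb hbn (by omega) (by omega) fun i hi => ?_
          rcases lt_trichotomy i j with hij | rfl | hij
          · have := monotoneOn_of_step hb (show i + 1 ≤ j from hij) hj.le
            exact Or.inl (Or.inr (by omega))
          · exact Or.inr (by omega)
          · have := monotoneOn_of_step hb (show j + 1 ≤ i from hij) hi.le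
            exact Or.inl (Or.inl (by omega))
        filter_upwards [hne] with x hx hxG
        have := exists_unique_min (m := b (j + 1) - b j - 1) (w := fun k =>
          ε * normalForm (edges (walk x) b : Fin r → EuclideanSpace ℝ (Fin (r + 1)))
            (walk x (b j + k))) fun p q hpq hq heq => ?_
        · simpa only [Set.mem_ofPred_eq, hxG, true_and] using this
        · refine hx p q hpq hq ?_
          rw [map_sub, sub_eq_zero]
          exact (mul_left_cancel₀ hε heq).symm
    have hterm : ∀ c ∈ Finset.range (b (j + 1) - b j - 1 + 1), ν.real
        {x | x ∈ G ∧ ∀ k ≤ b (j + 1) - b j - 1, k ≠ c →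
          ε * normalForm (edges (walk x) b : Fin r → EuclideanSpace ℝ (Fin (r + 1)))
              (walk x (b j + c))
            < ε * normalForm (edges (walk x) b : Fin r → EuclideanSpace ℝ (Fin (r + 1)))
              (walk x (b j + k))} = ν.real (G ∩ W) := by
      intro c hc
      have hc' : c < b (j + 1) - b j := by
        have := Finset.mem_range.1 hc
        omega
      have hmp := hperm (blockRot b j c hc'.le) fun i hi => by
        rw [blockRot, rotPerm_apply, if_neg (by omega)]
      rw [← hmp.measureReal_preimage
        (hGm.inter (measurableSet_blockOnSide ε b j)).nullMeasurableSet]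
      congr 1
      ext x
      exact and_congr (hGrot c hc'.le x).symm
        (mem_blockOnSide_comp_blockRot_iff ε x hb hj hc').symm
    rw [Finset.sum_congr rfl hterm, Finset.sum_const, Finset.card_range, nsmul_eq_mul] at hsum
    have hlen : ((b (j + 1) - b j - 1 + 1 : ℕ) : ℝ) = (b (j + 1) : ℝ) - b j := by
      rw [Nat.sub_add_cancel (by omega), Nat.cast_sub hbj.le]
    rw [hlen] at hsum
    rw [Finset.prod_insert hjJ, hset, ← ih hJ', ← hsum]
    ring

end Blocks

/-! ### Reduction to a real walk -/

/-- The permutation under which a walk first runs through the increments of the block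
`[s, s + L)`, then through those before the block, and then through the remaining ones. -/
def frontPerm (s L : ℕ) : Equiv.Perm ℕ where
  toFun j := if j < L then s + j else if j < L + s then j - L else j
  invFun j := if j < s then L + j else if j < s + L then j - s else j
  left_inv j := by dsimp only; split_ifs <;> omega
  right_inv j := by dsimp only; split_ifs <;> omega

lemma frontPerm_apply (s L j : ℕ) :
    frontPerm s L j = if j < L then s + j else if j < L + s then j - L else j := rfl

section FrontPerm

variable {V : Type*} [AddCommGroup V] (x : ℕ → V) {s L k : ℕ}

lemma walk_frontPerm_block (hk : k ≤ L) :
    walk (x ∘ frontPerm s L) k = walk x (s + k) - walk x s := by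
  rw [walk_add, add_sub_cancel_left]
  refine walk_congr fun j hj => ?_
  rw [Function.comp, frontPerm_apply, if_pos (by omega)]

lemma walk_frontPerm_before (hk : k ≤ s) :
    walk (x ∘ frontPerm s L) (L + k) = walk x (s + L) - walk x s + walk x k := by
  rw [walk_add, walk_frontPerm_block x le_rfl]
  congr 1
  refine walk_congr fun j hj => ?_
  rw [Function.comp, frontPerm_apply, if_neg (by omega), if_pos (by omega),
    Nat.add_sub_cancel_left]

lemma walk_frontPerm_after (hk : s ≤ k) :
    walk (x ∘ frontPerm s L) (L + k) = walk x (L + k) := by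
  refine walk_comp_perm x _ fun j => ?_
  rw [frontPerm_apply]
  split_ifs <;> omega

end FrontPerm

section Heights

variable {r : ℕ}

/-- The increments, after the time `L`, of the signed height of the walk over the hyperplane through
its values at the times `b 0, …, b r`. -/
noncomputable def heights (r : ℕ) (ε : ℝ) (b : ℕ → ℕ) (L : ℕ)
    (x : ℕ → EuclideanSpace ℝ (Fin (r + 1))) : ℕ → ℝ :=
  fun j => ε * normalForm (edges (walk x) b : Fin r → EuclideanSpace ℝ (Fin (r + 1))) (x (L + j))

lemma walk_heights (ε : ℝ) (b : ℕ → ℕ) (L : ℕ) (x : ℕ → EuclideanSpace ℝ (Fin (r + 1)))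
    (k : ℕ) : walk (heights r ε b L x) k = ε * normalForm
      (edges (walk x) b : Fin r → EuclideanSpace ℝ (Fin (r + 1)))
        (walk x (L + k) - walk x L) := by
  rw [walk_add, add_sub_cancel_left]
  exact map_walk (ε • normalForm (edges (walk x) b : Fin r → EuclideanSpace ℝ (Fin (r + 1)))) _ _

lemma measurable_heights (ε : ℝ) (b : ℕ → ℕ) (L : ℕ) : Measurable (heights r ε b L) :=
  measurable_pi_lambda _ fun j =>
    (measurable_normalForm_walk b (measurable_pi_apply (L + j))).const_mul ε

/-- Moving the blocks to the front decouples the condition on the walk inside the blocks from the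
condition on the rest, which becomes one on the position of the minimum of a real walk. -/
lemma onSide_iff_frontPerm (ε : ℝ) (x : ℕ → EuclideanSpace ℝ (Fin (r + 1))) {b : ℕ → ℕ}
    (hb : ∀ j < r, b j < b (j + 1)) (hb0 : b 0 = 0) {s m : ℕ} (hs : s ≤ m) :
    OnSide ε (walk x) (fun j => s + b j) (b r + m) ↔
      x ∘ frontPerm s (b r) ∈ {z | z ∈ heights r ε b (b r) ⁻¹' minAt m s ∧
        ∀ j ∈ Finset.range r, z ∈ blockOnSide r ε b j} := by
  set L := b r with hL
  set z := x ∘ frontPerm s L with hz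
  have hbL : ∀ j ≤ r, b j ≤ L := fun j hj => monotoneOn_of_step hb hj le_rfl
  have hedges : (edges (walk x) (fun j => s + b j) : Fin r → EuclideanSpace ℝ (Fin (r + 1)))
      = edges (walk z) b := by
    funext j
    simp only [edges]
    rw [hz, walk_frontPerm_block x (hbL _ j.2), walk_frontPerm_block x (hbL _ j.2.le)]
    abel
  set ψ := normalForm (edges (walk z) b : Fin r → EuclideanSpace ℝ (Fin (r + 1))) with hψ
  have hzero : ∀ j ≤ r, ψ (walk z (b j)) = 0 := fun j hj => by
    rw [hψ, normalForm_edges_eq hj, hb0, walk_zero, map_zero]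
  have hin : ∀ k ≤ L, ψ (walk x (s + k) - walk x s) = ψ (walk z k) := fun k hk => by
    rw [hz, walk_frontPerm_block x hk]
  have hbefore : ∀ k ≤ s, ψ (walk x k - walk x s) = ψ (walk z (L + k)) - ψ (walk z (L + s)) := by
    intro k hk
    rw [← map_sub, hz, walk_frontPerm_before x hk, walk_frontPerm_before x le_rfl]
    congr 1
    abel
  have hafter : ∀ k, s ≤ k →
      ψ (walk x (L + k) - walk x s) = ψ (walk z (L + k)) - ψ (walk z (L + s)) := by
    intro k hk
    have h1 := hin L le_rfl
    rw [hzero r le_rfl] at h1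
    have h2 : walk x (L + k) - walk x s
        = (walk z (L + k) - walk z (L + s)) + (walk x (s + L) - walk x s) := by
      rw [hz, walk_frontPerm_after x hk, walk_frontPerm_after x le_rfl, add_comm s L]
      abel
    rw [h2, map_add, h1, add_zero, map_sub]
  have hmin : z ∈ heights r ε b L ⁻¹' minAt m s ↔
      ∀ k ≤ m, k ≠ s → 0 < ε * (ψ (walk z (L + k)) - ψ (walk z (L + s))) := by
    refine forall_congr' fun k => forall₂_congr fun _ _ => ?_
    rw [walk_heights, walk_heights, ← hψ, ← sub_pos, ← mul_sub, ← map_sub, ← map_sub,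
      sub_sub_sub_cancel_right]
  have hblock : (∀ j ∈ Finset.range r, z ∈ blockOnSide r ε b j) ↔
      ∀ j < r, ∀ k, b j < k → k < b (j + 1) → 0 < ε * ψ (walk z k) := by
    simp only [Finset.mem_range]
    refine forall₂_congr fun j hj => forall_congr' fun k => forall₂_congr fun _ _ => ?_
    rw [← hψ, map_sub, hzero j hj.le, sub_zero]
  rw [Set.mem_ofPred_eq, hmin, hblock, OnSide, hedges, ← hψ, hb0, Nat.add_zero s]
  constructor
  · refine fun h => ⟨fun k hk hks => ?_, fun j hj k h1 h2 => ?_⟩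
    · rcases lt_or_gt_of_ne hks with hlt | hlt
      · rw [← hbefore k hlt.le]
        exact h k (by omega) fun j hj => by omega
      · rw [← hafter k hlt.le]
        refine h (L + k) (by omega) fun j hj => ?_
        have := hbL j hj
        omega
    · have hkL := hbL (j + 1) hj
      rw [← hin k (by omega)]
      refine h (s + k) (by omega) fun i hi => ?_
      have := outside_block hb hi hj
      omega
  · rintro ⟨h1, h2⟩ k hk hkb
    rcases lt_or_ge k s with hlt | hge
    · rw [hbefore k hlt.le]
      exact h1 k (by omega) hlt.ne
    · rcases Nat.lt_or_ge (s + L) k with hlt | hle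
      · obtain ⟨k, rfl⟩ := Nat.exists_eq_add_of_le (show L ≤ k by omega)
        rw [hafter k (by omega)]
        exact h1 k (by omega) (by omega)
      · obtain ⟨k, rfl⟩ := Nat.exists_eq_add_of_le hge
        rw [hin k (by omega)]
        have hk0 : b 0 < k := by
          have := hkb 0 (Nat.zero_le _)
          omega
        set j := Nat.findGreatest (fun j => b j < k) r with hj
        have hjk : b j < k := Nat.findGreatest_spec (P := fun j => b j < k) (Nat.zero_le r) hk0
        have hjr : j < r := by
          refine lt_of_le_of_ne (Nat.findGreatest_le r) fun hjr => ?_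
          rw [hjr] at hjk
          omega
        have hjk' : ¬ b (j + 1) < k := fun h =>
          absurd (Nat.le_findGreatest (P := fun j => b j < k) hjr h) (by omega)
        have := hkb (j + 1) hjr
        exact h2 j hjr k hjk (by omega)

variable {ν : Measure (ℕ → EuclideanSpace ℝ (Fin (r + 1)))}

lemma edges_comp_perm_of_le (x : ℕ → EuclideanSpace ℝ (Fin (r + 1))) {b : ℕ → ℕ}
    (hb : ∀ j < r, b j < b (j + 1)) {τ : Equiv.Perm ℕ} (hτ : ∀ j < b r, τ j = j) :
    (edges (walk (x ∘ τ)) b : Fin r → EuclideanSpace ℝ (Fin (r + 1))) = edges (walk x) b := by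
  have : ∀ j ≤ r, walk (x ∘ τ) (b j) = walk x (b j) := fun j hj => walk_congr fun i hi => by
    have := monotoneOn_of_step hb hj le_rfl
    rw [Function.comp, hτ i (by omega)]
  funext j
  simp only [edges]
  rw [this _ j.2, this _ j.2.le]

lemma permInvariant_map_heights {m : ℕ} (ε : ℝ) {b : ℕ → ℕ} (hb : ∀ j < r, b j < b (j + 1))
    (hperm : PermInvariant (b r + m) ν) :
    PermInvariant m (ν.map (heights r ε b (b r))) := by
  intro σ hσ
  have := MeasurePreserving.map_restrict_of_semiconj (hperm (shiftPerm (b r) σ) ?_)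
    MeasurableSet.univ rfl (measurable_heights ε b (b r)) (measurable_comp_index σ) fun x => ?_
  · rwa [Measure.restrict_univ] at this
  · intro j hj
    obtain ⟨i, rfl⟩ := Nat.exists_eq_add_of_le (show b r ≤ j by omega)
    rw [shiftPerm_add, hσ i (by omega)]
  · funext j
    simp only [heights, Function.comp]
    rw [shiftPerm_add, ← edges_comp_perm_of_le x hb fun j hj => shiftPerm_of_lt σ hj]

lemma flipInvariant_map_heights {m : ℕ} (ε : ℝ) {b : ℕ → ℕ} (hb : ∀ j < r, b j < b (j + 1))
    (hflip : FlipInvariant (b r + m) ν) :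
    FlipInvariant m (ν.map (heights r ε b (b r))) := by
  intro δ hδ hδ'
  have := MeasurePreserving.map_restrict_of_semiconj
    (hflip (fun j => if j < b r then 1 else δ (j - b r)) ?_ ?_)
    MeasurableSet.univ rfl (measurable_heights ε b (b r)) (measurable_flip δ) fun x => ?_
  · rwa [Measure.restrict_univ] at this
  · intro j
    by_cases h : j < b r
    · simp [h]
    · simpa [h] using hδ _
  · intro j hj
    rw [if_neg (by omega), hδ' _ (by omega)]
  · have hedges : (edges (walk fun j => (if j < b r then 1 else δ (j - b r)) • x j) b :
        Fin r → EuclideanSpace ℝ (Fin (r + 1))) = edges (walk x) b := by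
      have : ∀ j ≤ r, walk (fun j => (if j < b r then 1 else δ (j - b r)) • x j) (b j)
          = walk x (b j) := fun j hj => walk_congr fun i hi => by
        have := monotoneOn_of_step hb hj le_rfl
        rw [if_pos (by omega), one_smul]
      funext j
      simp only [edges]
      rw [this _ j.2, this _ j.2.le]
    funext j
    simp only [heights, hedges]
    simp
    ring

lemma tieFree_map_heights {m : ℕ} {ε : ℝ} (hε : ε ≠ 0) {b : ℕ → ℕ}
    (hb : ∀ j < r, b j < b (j + 1)) (hperm : PermInvariant (b r + m) ν)
    (hgp : ∀ᵐ x ∂ν, InGeneralPosition (walk x) (b r + m)) :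
    TieFree m (ν.map (heights r ε b (b r))) := by
  refine tieFree_map (measurable_heights ε b (b r)) ?_
  simp only [ae_all_iff]
  intro p q hpq hq
  filter_upwards [ae_normalForm_ne_zero hperm hgp hb (by omega) (show b r + p < b r + q by omega)
    (by omega) fun j hj => Or.inl (Or.inr (by
      have := monotoneOn_of_step hb (show j + 1 ≤ r from hj) le_rfl
      omega))] with x hx
  rw [walk_heights, walk_heights]
  intro h
  refine hx ?_
  have := mul_left_cancel₀ hε h
  rw [map_sub, map_sub] at this
  rw [map_sub]
  linarith

/-- The probability that the points at the times `s + b 0, …, s + b r` support the hull on the side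
`ε` is that of the corresponding position of the minimum of a real walk, divided by the lengths of
the blocks. -/
lemma measureReal_onSide_mul_prod [IsFiniteMeasure ν] {s m : ℕ} (hs : s ≤ m) {ε : ℝ} (hε : ε ≠ 0)
    {b : ℕ → ℕ} (hb : ∀ j < r, b j < b (j + 1)) (hb0 : b 0 = 0)
    (hperm : PermInvariant (b r + m) ν)
    (hgp : ∀ᵐ x ∂ν, InGeneralPosition (walk x) (b r + m)) :
    ν.real {x | OnSide ε (walk x) (fun j => s + b j) (b r + m)}
      * ∏ j ∈ Finset.range r, ((b (j + 1) : ℝ) - b j)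
        = (ν.map (heights r ε b (b r))).real (minAt m s) := by
  have hY : MeasurableSet (heights r ε b (b r) ⁻¹' minAt m s) :=
    measurable_heights ε b (b r) (measurableSet_minAt m s)
  rw [map_measureReal_apply (measurable_heights ε b (b r)) (measurableSet_minAt m s),
    ← measureReal_inter_blockOnSide hperm hgp hε hb (by omega) hY ?_ (Finset.range r)
      fun j hj => Finset.mem_range.1 hj]
  · congr 1
    have hmp := hperm (frontPerm s (b r)) fun j hj => by
      rw [frontPerm_apply, if_neg (by omega), if_neg (by omega)]
    have hset : MeasurableSet {z | z ∈ heights r ε b (b r) ⁻¹' minAt m s ∧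
        ∀ j ∈ Finset.range r, z ∈ blockOnSide r ε b j} := by
      rw [Set.ofPred_and]
      refine hY.inter ?_
      simp only [Set.ofPred_forall]
      exact MeasurableSet.iInter fun i => MeasurableSet.iInter fun _ =>
        measurableSet_blockOnSide ε b i
    rw [← hmp.measureReal_preimage hset.nullMeasurableSet]
    congr 1
    ext x
    exact onSide_iff_frontPerm ε x hb hb0 hs
  · intro j hj c hc x
    have : heights r ε b (b r) (x ∘ blockRot b j c hc) = heights r ε b (b r) x := by
      funext i
      simp only [heights, edges_comp_blockRot x hb hj hc, Function.comp]
      have h1 := monotoneOn_of_step hb (show j + 1 ≤ r from hj) le_rfl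
      have h2 := hb j hj
      rw [blockRot, rotPerm_apply, if_neg (by omega)]
    rw [Set.mem_preimage, this, Set.mem_preimage]

/-- Summation over all shifts of the candidate facet: the minimum is attained somewhere. -/
lemma sum_measureReal_onSide [IsProbabilityMeasure ν] {n m : ℕ} {ε : ℝ} (hε : ε ≠ 0)
    {b : ℕ → ℕ} (hb : ∀ j < r, b j < b (j + 1)) (hb0 : b 0 = 0) (hn : n = b r + m)
    (hperm : PermInvariant n ν) (hgp : ∀ᵐ x ∂ν, InGeneralPosition (walk x) n) :
    (∑ s ∈ Finset.range (m + 1), ν.real {x | OnSide ε (walk x) (fun j => s + b j) n})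
      * ∏ j ∈ Finset.range r, ((b (j + 1) : ℝ) - b j) = 1 := by
  subst hn
  have := Measure.isProbabilityMeasure_map (μ := ν) (measurable_heights ε b (b r)).aemeasurable
  rw [Finset.sum_mul, Finset.sum_congr rfl fun s hs => measureReal_onSide_mul_prod
    (Nat.le_of_lt_succ (Finset.mem_range.1 hs)) hε hb hb0 hperm hgp,
    sum_measureReal_minAt (tieFree_map_heights hε hb hperm hgp), probReal_univ]

lemma measureReal_onSide_of_flipInvariant [IsProbabilityMeasure ν] {n s t : ℕ} {ε : ℝ}
    (hε : ε ≠ 0) {b : ℕ → ℕ} (hb : ∀ j < r, b j < b (j + 1)) (hb0 : b 0 = 0)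
    (hn : n = b r + (s + t)) (hperm : PermInvariant n ν) (hflip : FlipInvariant n ν)
    (hgp : ∀ᵐ x ∂ν, InGeneralPosition (walk x) n) :
    ν.real {x | OnSide ε (walk x) (fun j => s + b j) n}
      * ∏ j ∈ Finset.range r, ((b (j + 1) : ℝ) - b j) = persistProb s * persistProb t := by
  subst hn
  have := Measure.isProbabilityMeasure_map (μ := ν) (measurable_heights ε b (b r)).aemeasurable
  rw [measureReal_onSide_mul_prod (by omega) hε hb hb0 hperm hgp,
    measureReal_minAt (permInvariant_map_heights ε hb hperm)
      (flipInvariant_map_heights ε hb hflip) (tieFree_map_heights hε hb hperm hgp),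
    probReal_univ, mul_one]

end Heights

/-! ### Bridges -/

section Bridge

variable {r n : ℕ}

/-- A cyclic shift of the increments of a closed walk translates the set of its points. -/
lemma onSide_iff_rotPerm (ε : ℝ) {x : ℕ → EuclideanSpace ℝ (Fin (r + 1))}
    (hx : walk x (n + 1) = 0) {b : ℕ → ℕ} (hb : ∀ j < r, b j < b (j + 1)) (hb0 : b 0 = 0) {s : ℕ}
    (hs : s + b r ≤ n) (hs' : s ≤ n + 1) :
    OnSide ε (walk x) (fun j => s + b j) n ↔ OnSide ε (walk (x ∘ rotPerm 0 (n + 1) s hs')) b n := by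
  set z := x ∘ rotPerm 0 (n + 1) s hs' with hz
  have hbL : ∀ j ≤ r, b j ≤ b r := fun j hj => monotoneOn_of_step hb hj le_rfl
  have hval : ∀ t ≤ n + 1, walk z t = (if s + t ≤ n + 1 then walk x (s + t)
      else walk x (s + t - (n + 1))) - walk x s := by
    intro t ht
    have h := walk_comp_rotPerm x (a := 0) hs' ht
    simp only [zero_add, walk_zero, hx] at h
    rw [hz, h]
    split_ifs <;> abel
  have hedges : (edges (walk x) (fun j => s + b j) : Fin r → EuclideanSpace ℝ (Fin (r + 1)))
      = edges (walk z) b := by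
    funext j
    have h1 := hbL (j + 1) j.2
    have h2 := hbL _ j.2.le
    simp only [edges]
    rw [hval _ (by omega), hval _ (by omega), if_pos (by omega), if_pos (by omega)]
    abel
  rw [OnSide, OnSide, hedges, hb0, walk_zero, Nat.add_zero s]
  simp only [sub_zero]
  constructor
  · intro h k hk hkb
    rw [hval k (by omega)]
    have hk0 : k ≠ 0 := hb0 ▸ hkb 0 (Nat.zero_le _)
    rcases lt_trichotomy (s + k) (n + 1) with hlt | heq | hlt
    · rw [if_pos hlt.le]
      refine h _ (by omega) fun j hj => ?_
      have := hkb j hj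
      omega
    · rw [if_pos heq.le, heq, hx, ← walk_zero x]
      exact h 0 (by omega) fun j hj => by have := hbL j hj; omega
    · rw [if_neg hlt.not_ge]
      refine h _ (by omega) fun j hj => ?_
      omega
  · intro h k hk hkb
    have hks : k ≠ s := by
      have := hkb 0 (Nat.zero_le _)
      omega
    rcases lt_or_gt_of_ne hks with hlt | hlt
    · have hv := hval (n + 1 + k - s) (by omega)
      have hw : walk x k - walk x s = walk z (n + 1 + k - s) := by
        rw [hv]
        split_ifs with hc
        · rw [show s + (n + 1 + k - s) = n + 1 by omega, hx, show k = 0 by omega, walk_zero]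
        · rw [show s + (n + 1 + k - s) - (n + 1) = k by omega]
      rw [hw]
      exact h _ (by omega) fun j hj => by have := hbL j hj; omega
    · have hv := hval (k - s) (by omega)
      rw [if_pos (by omega), show s + (k - s) = k by omega] at hv
      rw [← hv]
      refine h _ (by omega) fun j hj => ?_
      have := hkb j hj
      omega

lemma measureReal_onSide_bridge {ν : Measure (ℕ → EuclideanSpace ℝ (Fin (r + 1)))}
    (hperm : PermInvariant (n + 1) ν) (hbridge : ∀ᵐ x ∂ν, walk x (n + 1) = 0) (ε : ℝ) {b : ℕ → ℕ}
    (hb : ∀ j < r, b j < b (j + 1)) (hb0 : b 0 = 0) {s : ℕ} (hs : s + b r ≤ n) :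
    ν.real {x | OnSide ε (walk x) (fun j => s + b j) n} = ν.real {x | OnSide ε (walk x) b n} := by
  have hs' : s ≤ n + 1 := by omega
  have hmp := hperm (rotPerm 0 (n + 1) s hs') fun j hj => by
    rw [rotPerm_apply, if_neg (by omega)]
  rw [← hmp.measureReal_preimage (measurableSet_onSide ε b n).nullMeasurableSet]
  refine measureReal_congr ?_
  filter_upwards [hbridge] with x hx
  exact propext (onSide_iff_rotPerm ε hx hb hb0 hs hs')

end Bridge

/-! ### The law of the path -/

/-- A finite sequence of increments, continued by zeros. -/
def extendZero {V : Type*} [Zero V] {N : ℕ} (x : Fin N → V) : ℕ → V :=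
  fun j => if h : j < N then x ⟨j, h⟩ else 0

lemma walk_extendZero {Ω : Type*} {d N : ℕ} (X : Fin N → Ω → EuclideanSpace ℝ (Fin d)) (k : ℕ)
    (ω : Ω) : walk (extendZero fun j => X j ω) k = partialSum X k ω := by
  have h1 : partialSum X k ω
      = ∑ j ∈ (Finset.range N).filter (· < k), extendZero (fun j => X j ω) j := by
    rw [partialSum, Finset.sum_filter, Finset.sum_filter, ← Fin.sum_univ_eq_sum_range
      (fun j => if j < k then extendZero (fun j => X j ω) j else 0)]
    exact Finset.sum_congr rfl fun j _ => by simp [extendZero]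
  rw [h1, walk]
  symm
  refine Finset.sum_subset (fun j hj => ?_) fun j hj hj' => ?_
  · simp at hj ⊢
    exact hj.2
  · simp at hj hj'
    simp [extendZero]
    intro h
    omega

section PathLaw

variable {Ω : Type*} [MeasurableSpace Ω] {μ : Measure Ω} {d N : ℕ}
  {X : Fin N → Ω → EuclideanSpace ℝ (Fin d)}

lemma measurable_extendZero :
    Measurable (extendZero : (Fin N → EuclideanSpace ℝ (Fin d)) → ℕ → _) := by
  refine measurable_pi_lambda _ fun j => ?_
  by_cases h : j < N
  · simpa only [extendZero, h, dif_pos] using measurable_pi_apply _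
  · simpa only [extendZero, h, dif_neg, not_false_eq_true] using measurable_const

/-- The law on path space of the walk with increments `X`. -/
noncomputable def pathLaw (μ : Measure Ω) (X : Fin N → Ω → EuclideanSpace ℝ (Fin d)) :
    Measure (ℕ → EuclideanSpace ℝ (Fin d)) :=
  μ.map fun ω => extendZero fun j => X j ω

lemma measurable_path (hX : ∀ j, Measurable (X j)) :
    Measurable fun ω => extendZero fun j => X j ω :=
  measurable_extendZero.comp (measurable_pi_lambda _ hX)

lemma measurePreserving_pathLaw (hX : ∀ j, Measurable (X j))
    {X' : Fin N → Ω → EuclideanSpace ℝ (Fin d)}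
    (h : IdentDistrib (fun ω j => X' j ω) (fun ω j => X j ω) μ μ)
    (hX' : ∀ j, Measurable (X' j))
    {T : (ℕ → EuclideanSpace ℝ (Fin d)) → ℕ → EuclideanSpace ℝ (Fin d)} (hT : Measurable T)
    (hTX : ∀ ω, T (extendZero fun j => X j ω) = extendZero fun j => X' j ω) :
    MeasurePreserving T (pathLaw μ X) (pathLaw μ X) := by
  refine ⟨hT, ?_⟩
  rw [pathLaw, Measure.map_map hT (measurable_path hX)]
  have h1 : (T ∘ fun ω => extendZero fun j => X j ω) = extendZero ∘ fun ω j => X' j ω :=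
    funext hTX
  rw [h1, ← Measure.map_map measurable_extendZero (measurable_pi_lambda _ hX'), h.map_eq,
    Measure.map_map measurable_extendZero (measurable_pi_lambda _ hX)]
  rfl

lemma permInvariant_pathLaw (hX : ∀ j, Measurable (X j)) (hex : Exchangeable μ X) :
    PermInvariant N (pathLaw μ X) := by
  intro σ hσ
  have hlt := perm_lt_iff hσ
  refine measurePreserving_pathLaw hX (hex (σ.subtypePerm (p := (· < N)) (fun j => (hlt j).symm) |>
    Fin.equivSubtype.symm.permCongr)) (fun j => hX _) (measurable_comp_index σ) fun ω => ?_
  funext j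
  by_cases h : j < N
  · simp [extendZero, h, (hlt j).1 h, Equiv.permCongr_apply]
  · simp [extendZero, h, mt (hlt j).2 h]

lemma flipInvariant_pathLaw (hX : ∀ j, Measurable (X j)) (hsign : SignInvariant μ X) :
    FlipInvariant N (pathLaw μ X) := by
  intro ε hε _
  refine measurePreserving_pathLaw hX (hsign (fun j => ε j) fun j => hε j)
    (fun j => (hX j).const_smul (ε j)) (measurable_flip ε) fun ω => ?_
  funext j
  by_cases h : j < N <;> simp [extendZero, h]

lemma PermInvariant.mono {V : Type*} [MeasurableSpace V] {ν : Measure (ℕ → V)} {m n : ℕ}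
    (h : PermInvariant n ν) (hmn : m ≤ n) : PermInvariant m ν :=
  fun σ hσ => h σ fun j hj => hσ j (hmn.trans hj)

lemma ae_inGeneralPosition_pathLaw {n : ℕ} (hX : ∀ j, Measurable (X j))
    (h : ∀ᵐ ω ∂μ, InGeneralPosition (fun k => partialSum X k ω) n) :
    ∀ᵐ x ∂pathLaw μ X, InGeneralPosition (walk x) n := by
  rw [pathLaw, ae_map_iff (measurable_path hX).aemeasurable]
  · filter_upwards [h] with ω hω
    rwa [show walk (extendZero fun j => X j ω) = fun k => partialSum X k ω from
      funext fun k => walk_extendZero X k ω]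
  · simp only [InGeneralPosition, Set.ofPred_forall]
    refine MeasurableSet.iInter fun k => MeasurableSet.iInter fun _ => MeasurableSet.iInter fun _ =>
      ?_
    have hm : Measurable fun (x : ℕ → EuclideanSpace ℝ (Fin d)) (j : Fin d) => walk x (k j) :=
      measurable_pi_lambda _ fun j => measurable_walk _
    exact hm isOpen_setOfPred_linearIndependent.measurableSet

end PathLaw

/-- The probability of the face event, expressed on path space. The event is only almost surely
equal to a measurable one. -/
lemma measureReal_faceEvent {Ω : Type*} [MeasurableSpace Ω] {μ : Measure Ω} [IsFiniteMeasure μ]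
    {r n N : ℕ} {X : Fin N → Ω → EuclideanSpace ℝ (Fin (r + 1))} (hX : ∀ j, Measurable (X j))
    (hrn : r + 1 ≤ n) (hperm : PermInvariant n (pathLaw μ X))
    (hgp : ∀ᵐ ω ∂μ, InGeneralPosition (fun k => partialSum X k ω) n) {i b : ℕ → ℕ}
    (hib : ∀ j ≤ r, i (j + 1) = b j) (hb : ∀ j < r, b j < b (j + 1)) (hbn : b r ≤ n) :
    μ.real (faceEvent (partialSum X) n i) = (pathLaw μ X).real {x | OnSide 1 (walk x) b n}
      + (pathLaw μ X).real {x | OnSide (-1) (walk x) b n} := by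
  have : IsFiniteMeasure (pathLaw μ X) := by unfold pathLaw; infer_instance
  obtain ⟨F', hF', hae, heq⟩ := measureReal_facet hrn hperm (ae_inGeneralPosition_pathLaw hX hgp)
    hb hbn (F := {x | convexHull ℝ ((fun j => walk x (b j)) '' Set.Iic r)
      ∈ facets (hullUpTo (walk x) n)}) fun x => Iff.rfl
  rw [← heq]
  have hpath := measurable_path hX
  rw [pathLaw, map_measureReal_apply hpath hF']
  refine measureReal_congr ?_
  refine Filter.EventuallyEq.trans (Filter.Eventually.of_forall fun ω => ?_)
    ((hpath.measurePreserving μ).quasiMeasurePreserving.preimage_ae_eq hae)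
  have hwalk : walk (extendZero fun j => X j ω) = fun k => partialSum X k ω :=
    funext fun k => walk_extendZero X k ω
  have himage : (fun k => partialSum X (i k) ω) '' Set.Icc 1 (r + 1)
      = (fun j => partialSum X (b j) ω) '' Set.Iic r := by
    ext y
    constructor
    · rintro ⟨k, ⟨hk1, hk2⟩, rfl⟩
      obtain ⟨j, rfl⟩ := Nat.exists_eq_add_of_le' hk1
      exact ⟨j, by simpa using hk2, by simp only [hib j (by omega)]⟩
    · rintro ⟨j, hj, rfl⟩
      exact ⟨j + 1, ⟨by omega, Nat.succ_le_succ hj⟩, by simp only [hib j hj]⟩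
  refine propext ?_
  change convexHull ℝ _ ∈ facets (hullUpTo _ n) ↔ convexHull ℝ _ ∈ facets (hullUpTo _ n)
  rw [himage, hwalk]

/-! ### Independent symmetric increments -/

section Independent

variable {Ω : Type*} [MeasurableSpace Ω] {μ : Measure Ω} [IsProbabilityMeasure μ] {d N : ℕ}
  {X : Fin N → Ω → EuclideanSpace ℝ (Fin d)}

lemma identDistrib_of_iIndepFun {X' : Fin N → Ω → EuclideanSpace ℝ (Fin d)}
    (hX : ∀ j, Measurable (X j)) (hX' : ∀ j, Measurable (X' j)) (hind : iIndepFun X μ)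
    (hind' : iIndepFun X' μ) (h : ∀ j, μ.map (X' j) = μ.map (X j)) :
    IdentDistrib (fun ω j => X' j ω) (fun ω j => X j ω) μ μ where
  aemeasurable_fst := (measurable_pi_lambda _ hX').aemeasurable
  aemeasurable_snd := (measurable_pi_lambda _ hX).aemeasurable
  map_eq := by
    rw [(iIndepFun_iff_map_fun_eq_pi_map fun j => (hX' j).aemeasurable).1 hind',
      (iIndepFun_iff_map_fun_eq_pi_map fun j => (hX j).aemeasurable).1 hind]
    simp only [h]

lemma exchangeable_of_iIndepFun (hX : ∀ j, Measurable (X j)) (hind : iIndepFun X μ)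
    (hid : ∀ j j', IdentDistrib (X j) (X j') μ μ) : Exchangeable μ X := fun σ =>
  identDistrib_of_iIndepFun hX (fun j => hX (σ j)) hind (hind.precomp σ.injective)
    fun j => (hid (σ j) j).map_eq

lemma signInvariant_of_iIndepFun (hX : ∀ j, Measurable (X j)) (hind : iIndepFun X μ)
    (hsymm : ∀ j, IdentDistrib (X j) (fun ω => -X j ω) μ μ) : SignInvariant μ X := by
  intro ε hε
  refine identDistrib_of_iIndepFun (X' := fun j ω => ε j • X j ω) hX
    (fun j => (hX j).const_smul (ε j)) hind
    (hind.comp (fun j x => ε j • x) fun j => measurable_const_smul (ε j)) fun j => ?_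
  rcases hε j with h | h
  · simp [h]
  · simpa [h] using (hsymm j).map_eq.symm

/-- An independent increment without mass on hyperplanes almost surely leads out of the span of
fewer than `d` vectors. -/
lemma ae_linearIndependent_snoc_add {q : ℕ} (hq : q < d)
    {U : Ω → (Fin q → EuclideanSpace ℝ (Fin d)) × EuclideanSpace ℝ (Fin d)}
    {Y : Ω → EuclideanSpace ℝ (Fin d)} (hU : Measurable U) (hY : Measurable Y)
    (hind : IndepFun U Y μ) (hnull : NullOnHyperplanes μ Y) :
    ∀ᵐ ω ∂μ, LinearIndependent ℝ (U ω).1 →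
      LinearIndependent ℝ (Fin.snoc (U ω).1 ((U ω).2 + Y ω) : Fin (q + 1) → _) := by
  set B : Set (((Fin q → EuclideanSpace ℝ (Fin d)) × EuclideanSpace ℝ (Fin d)) ×
      EuclideanSpace ℝ (Fin d)) := {p | LinearIndependent ℝ p.1.1 ∧
        ¬ LinearIndependent ℝ (Fin.snoc p.1.1 (p.1.2 + p.2) : Fin (q + 1) → _)} with hB
  have hBm : MeasurableSet B := by
    have hopen : ∀ q, IsOpen {f : Fin q → EuclideanSpace ℝ (Fin d) | LinearIndependent ℝ f} :=
      fun _ => isOpen_setOfPred_linearIndependent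
    have h1 : IsOpen {p : ((Fin q → EuclideanSpace ℝ (Fin d)) × EuclideanSpace ℝ (Fin d)) ×
        EuclideanSpace ℝ (Fin d) | LinearIndependent ℝ p.1.1} :=
      (hopen q).preimage (by fun_prop)
    have hc : Continuous fun p : ((Fin q → EuclideanSpace ℝ (Fin d)) × EuclideanSpace ℝ (Fin d)) ×
        EuclideanSpace ℝ (Fin d) =>
        (Fin.snoc p.1.1 (p.1.2 + p.2) : Fin (q + 1) → EuclideanSpace ℝ (Fin d)) :=
      Continuous.finSnoc (by fun_prop) (by fun_prop)
    have h2 := (hopen (q + 1)).preimage hc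
    exact h1.measurableSet.inter h2.measurableSet.compl
  have hzero : μ {ω | (U ω, Y ω) ∈ B} = 0 := by
    have hmap := (indepFun_iff_map_prod_eq_prod_map_map hU.aemeasurable hY.aemeasurable).1 hind
    have h1 : μ {ω | (U ω, Y ω) ∈ B} = (μ.map fun ω => (U ω, Y ω)) B :=
      (Measure.map_apply (hU.prodMk hY) hBm).symm
    rw [h1, hmap]
    have := Measure.isProbabilityMeasure_map (μ := μ) hY.aemeasurable
    rw [Measure.measure_prod_null hBm]
    refine Filter.Eventually.of_forall fun p => ?_
    obtain ⟨v, s⟩ := p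
    have hspan : Submodule.span ℝ (Set.range v) ≠ ⊤ := by
      intro h
      have h1 := finrank_range_le_card (R := ℝ) v
      rw [Set.finrank, h, finrank_top, finrank_euclideanSpace_fin, Fintype.card_fin] at h1
      omega
    have hperp : (Submodule.span ℝ (Set.range v))ᗮ ≠ ⊥ := fun h =>
      hspan (Submodule.orthogonal_eq_bot_iff.1 h)
    obtain ⟨u, hu, hu0⟩ := Submodule.exists_mem_ne_zero_of_ne_bot hperp
    change (μ.map Y) (Prod.mk (v, s) ⁻¹' B) = 0
    rw [Measure.map_apply hY (measurable_prodMk_left hBm)]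
    refine measure_mono_null (fun ω hω => ?_) (hnull u hu0 (-inner ℝ u s))
    have hmem : s + Y ω ∈ Submodule.span ℝ (Set.range v) := by
      by_contra hc
      exact hω.2 (linearIndependent_finSnoc.2 ⟨hω.1, hc⟩)
    have := Submodule.inner_left_of_mem_orthogonal hmem hu
    rw [inner_add_right] at this
    exact eq_neg_of_add_eq_zero_right this
  have : ∀ᵐ ω ∂μ, (U ω, Y ω) ∉ B := measure_eq_zero_iff_ae_notMem.1 hzero
  filter_upwards [this] with ω hω hli
  by_contra hc
  exact hω ⟨hli, hc⟩

/-- The last increment before the latest of the chosen times is independent of the walk at the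
earlier ones, so the values of the walk at the chosen times stay independent as times are added.
-/
lemma ae_linearIndependent_partialSum (hX : ∀ j, Measurable (X j)) (hind : iIndepFun X μ)
    (hnull : ∀ j, NullOnHyperplanes μ (X j)) {q : ℕ} (hq : q ≤ d) (k : Fin q → ℕ)
    (hk : StrictMono k) (hk1 : ∀ j, 1 ≤ k j ∧ k j ≤ N) :
    ∀ᵐ ω ∂μ, LinearIndependent ℝ fun j => partialSum X (k j) ω := by
  classical
  induction q with
  | zero => exact Filter.Eventually.of_forall fun ω => linearIndependent_empty_type
  | succ q ih =>
    have hih := ih (by omega) (fun j => k j.castSucc) (hk.comp (Fin.strictMono_castSucc))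
      fun j => hk1 _
    obtain ⟨l, hl⟩ := Nat.exists_eq_add_of_le' (hk1 (Fin.last q)).1
    have hlN : l < N := by have := (hk1 (Fin.last q)).2; omega
    set S : Finset (Fin N) := Finset.univ.filter fun j => j.val < l with hS
    set T : Finset (Fin N) := {⟨l, hlN⟩} with hT
    have hST : Disjoint S T := by
      rw [Finset.disjoint_singleton_right]
      simp [hS]
    have hindST := hind.indepFun_finset S T hST hX
    set P : ℕ → (S → EuclideanSpace ℝ (Fin d)) → EuclideanSpace ℝ (Fin d) :=
      fun a p => ∑ j : S, if j.1.val < a then p j else 0 with hP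
    have hPm : ∀ a, Measurable (P a) := fun a => by
      refine Finset.measurable_sum _ fun j _ => ?_
      by_cases h : j.1.val < a
      · simpa only [h, if_true] using measurable_pi_apply j
      · simpa only [h, if_false] using measurable_const
    have hPX : ∀ a ≤ l, ∀ ω, P a (fun j => X j ω) = partialSum X a ω := by
      intro a ha ω
      simp only [hP, partialSum]
      rw [Finset.sum_coe_sort S fun j => if j.val < a then X j ω else 0, ← Finset.sum_filter]
      refine Finset.sum_congr ?_ fun _ _ => rfl
      ext j
      simp only [hS, Finset.mem_filter, Finset.mem_univ, true_and]
      omega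
    have hUm : Measurable fun p : S → EuclideanSpace ℝ (Fin d) =>
        ((fun j : Fin q => P (k j.castSucc) p), P l p) :=
      (measurable_pi_lambda _ fun j => hPm _).prodMk (hPm l)
    have hYm : Measurable fun p : T → EuclideanSpace ℝ (Fin d) =>
        p ⟨⟨l, hlN⟩, Finset.mem_singleton_self _⟩ := measurable_pi_apply _
    have hkey := ae_linearIndependent_snoc_add (by omega)
      (hUm.comp (measurable_pi_lambda (fun ω (j : S) => X j ω) fun j => hX j))
      (hYm.comp (measurable_pi_lambda (fun ω (j : T) => X j ω) fun j => hX j))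
      (hindST.comp hUm hYm) (hnull ⟨l, hlN⟩)
    filter_upwards [hih, hkey] with ω h1 h2
    have hle : ∀ j : Fin q, k j.castSucc ≤ l := fun j => by
      have := hk (Fin.castSucc_lt_last j)
      omega
    have hinit : (fun j : Fin q => P (k j.castSucc) (fun j => X j ω))
        = fun j => partialSum X (k j.castSucc) ω := funext fun j => hPX _ (hle j) ω
    have hlast : partialSum X (k (Fin.last q)) ω = partialSum X l ω + X ⟨l, hlN⟩ ω := by
      rw [hl, ← walk_extendZero, ← walk_extendZero, walk_succ]
      simp [extendZero, hlN]
    simp only [Function.comp, hinit, hPX l le_rfl] at h2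
    have := h2 h1
    rw [← hlast] at this
    convert! this using 1
    funext j
    refine Fin.lastCases ?_ (fun j => ?_) j <;> simp

lemma ae_inGeneralPosition_of_iIndepFun (hX : ∀ j, Measurable (X j)) (hind : iIndepFun X μ)
    (hnull : ∀ j, NullOnHyperplanes μ (X j)) :
    ∀ᵐ ω ∂μ, InGeneralPosition (fun k => partialSum X k ω) N := by
  simp only [InGeneralPosition, ae_all_iff]
  intro k hk hk1
  have hmono : StrictMono (k ∘ Tuple.sort k) :=
    (Tuple.monotone_sort k).strictMono_of_injective (hk.comp (Tuple.sort k).injective)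
  filter_upwards [ae_linearIndependent_partialSum hX hind hnull le_rfl _ hmono fun j => hk1 _]
    with ω hω
  exact (linearIndependent_equiv (Tuple.sort k)).1 hω

end Independent

/-! ### The face probabilities -/

section FaceProbabilities

variable {Ω : Type*} [MeasurableSpace Ω] {μ : Measure Ω} [IsProbabilityMeasure μ] {r n : ℕ}
  {i : ℕ → ℕ}

lemma isProbabilityMeasure_pathLaw {N d : ℕ} {X : Fin N → Ω → EuclideanSpace ℝ (Fin d)}
    (hX : ∀ j, Measurable (X j)) : IsProbabilityMeasure (pathLaw μ X) :=
  Measure.isProbabilityMeasure_map (measurable_path hX).aemeasurable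

lemma apply_one_le_of_strictMonoOn (hi : StrictMonoOn i (Set.Icc 1 (r + 1))) {j : ℕ} (hj : j ≤ r) :
    i 1 ≤ i (j + 1) :=
  hi.monotoneOn ⟨le_rfl, by omega⟩ ⟨by omega, by omega⟩ (by omega)

lemma lt_apply_succ_of_strictMonoOn (hi : StrictMonoOn i (Set.Icc 1 (r + 1))) {j : ℕ}
    (hj : j < r) : i (j + 1) < i (j + 1 + 1) :=
  hi ⟨by omega, by omega⟩ ⟨by omega, by omega⟩ (by omega)

lemma prod_Ico_eq_prod_range_sub (hi : StrictMonoOn i (Set.Icc 1 (r + 1))) :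
    ∏ k ∈ Finset.Ico 1 (r + 1), ((i (k + 1) : ℝ) - (i k : ℝ))
      = ∏ j ∈ Finset.range r, (((i (j + 1 + 1) - i 1 : ℕ) : ℝ) - ((i (j + 1) - i 1 : ℕ) : ℝ)) := by
  rw [Finset.prod_Ico_eq_prod_range, Nat.add_sub_cancel]
  refine Finset.prod_congr rfl fun j hj => ?_
  have hj := Finset.mem_range.1 hj
  rw [Nat.cast_sub (apply_one_le_of_strictMonoOn hi (show j + 1 ≤ r from hj)),
    Nat.cast_sub (apply_one_le_of_strictMonoOn hi hj.le), add_comm 1 j]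
  ring

lemma prod_Ico_pos (hi : StrictMonoOn i (Set.Icc 1 (r + 1))) :
    0 < ∏ k ∈ Finset.Ico 1 (r + 1), ((i (k + 1) : ℝ) - (i k : ℝ)) := by
  refine Finset.prod_pos fun k hk => sub_pos.2 ?_
  rw [Finset.mem_Ico] at hk
  exact_mod_cast hi ⟨hk.1, hk.2.le⟩ ⟨by omega, by omega⟩ (Nat.lt_succ_self k)

/-- The face probabilities of all shifts add up to `2 / ∏`: each of the two sides contributes the
inverse of the product of the block lengths. -/
lemma sum_measureReal_faceEvent (hrn : r + 1 ≤ n) (hi : StrictMonoOn i (Set.Icc 1 (r + 1)))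
    (hin : i (r + 1) ≤ n) {N : ℕ} {X : Fin N → Ω → EuclideanSpace ℝ (Fin (r + 1))}
    (hX : ∀ j, Measurable (X j)) (hperm : PermInvariant n (pathLaw μ X))
    (hgp : ∀ᵐ ω ∂μ, InGeneralPosition (fun k => partialSum X k ω) n) :
    ∑ s ∈ Finset.range (n - i (r + 1) + i 1 + 1),
        μ.real (faceEvent (partialSum X) n (fun k => s + (i k - i 1)))
      = 2 / ∏ k ∈ Finset.Ico 1 (r + 1), ((i (k + 1) : ℝ) - (i k : ℝ)) := by
  have := isProbabilityMeasure_pathLaw (μ := μ) hX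
  have h1 := apply_one_le_of_strictMonoOn hi le_rfl
  have hb : ∀ j < r, i (j + 1) - i 1 < i (j + 1 + 1) - i 1 := fun j hj => by
    have := apply_one_le_of_strictMonoOn hi hj.le
    have := lt_apply_succ_of_strictMonoOn hi hj
    omega
  have hside : ∀ ε : ℝ, ε ≠ 0 → _ := fun ε hε =>
    sum_measureReal_onSide (b := fun j => i (j + 1) - i 1) hε hb (Nat.sub_self _)
      (m := n - i (r + 1) + i 1) (by omega) hperm (ae_inGeneralPosition_pathLaw hX hgp)
  have hterm : ∀ s ∈ Finset.range (n - i (r + 1) + i 1 + 1), _ := fun s hs =>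
    measureReal_faceEvent hX hrn hperm hgp (i := fun k => s + (i k - i 1))
      (b := fun j => s + (i (j + 1) - i 1)) (fun _ _ => rfl)
      (fun j hj => Nat.add_lt_add_left (hb j hj) s)
      (by have := Finset.mem_range.1 hs; omega)
  rw [Finset.sum_congr rfl hterm, Finset.sum_add_distrib, eq_div_iff (prod_Ico_pos hi).ne', add_mul,
    prod_Ico_eq_prod_range_sub hi, hside 1 one_ne_zero, hside (-1) (by norm_num)]
  norm_num

lemma measureReal_faceEvent_of_flipInvariant (hrn : r + 1 ≤ n)
    (hi : StrictMonoOn i (Set.Icc 1 (r + 1))) (hin : i (r + 1) ≤ n) {N : ℕ}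
    {X : Fin N → Ω → EuclideanSpace ℝ (Fin (r + 1))}
    (hX : ∀ j, Measurable (X j)) (hperm : PermInvariant n (pathLaw μ X))
    (hflip : FlipInvariant n (pathLaw μ X))
    (hgp : ∀ᵐ ω ∂μ, InGeneralPosition (fun k => partialSum X k ω) n) :
    μ.real (faceEvent (partialSum X) n i)
      = 2 * (((2 * i 1 - 1)‼ : ℝ) / ((2 * i 1)‼ : ℝ)) *
          (((2 * n - 2 * i (r + 1) - 1)‼ : ℝ) / ((2 * n - 2 * i (r + 1))‼ : ℝ)) *
          ∏ k ∈ Finset.Ico 1 (r + 1), 1 / ((i (k + 1) : ℝ) - (i k : ℝ)) := by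
  have := isProbabilityMeasure_pathLaw (μ := μ) hX
  have hb : ∀ j < r, i (j + 1) - i 1 < i (j + 1 + 1) - i 1 := fun j hj => by
    have := apply_one_le_of_strictMonoOn hi hj.le
    have := lt_apply_succ_of_strictMonoOn hi hj
    omega
  have hside : ∀ ε : ℝ, ε ≠ 0 → _ := fun ε hε =>
    measureReal_onSide_of_flipInvariant (b := fun j => i (j + 1) - i 1) hε hb (Nat.sub_self _)
      (s := i 1) (t := n - i (r + 1))
      (by have := apply_one_le_of_strictMonoOn hi le_rfl; omega) hperm hflip
      (ae_inGeneralPosition_pathLaw hX hgp)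
  have hp2 : (((2 * n - 2 * i (r + 1) - 1)‼ : ℝ) / ((2 * n - 2 * i (r + 1))‼ : ℝ))
      = persistProb (n - i (r + 1)) := by
    rw [persistProb, Nat.mul_sub]
  rw [measureReal_faceEvent hX hrn hperm hgp (b := fun j => i 1 + (i (j + 1) - i 1))
    (fun j hj => by have := apply_one_le_of_strictMonoOn hi hj; omega)
    (fun j hj => Nat.add_lt_add_left (hb j hj) _)
    (by have := apply_one_le_of_strictMonoOn hi le_rfl; omega), hp2, Finset.prod_div_distrib,
    Finset.prod_const_one, mul_one_div, eq_div_iff (prod_Ico_pos hi).ne', add_mul,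
    prod_Ico_eq_prod_range_sub hi, hside 1 one_ne_zero, hside (-1) (by norm_num), persistProb]
  ring

/-- For a bridge all shifts of the face have equal probabilities, so each is an equal share of their
sum. -/
lemma measureReal_faceEvent_bridge (hrn : r + 1 ≤ n)
    (hi : StrictMonoOn i (Set.Icc 1 (r + 1))) (hin : i (r + 1) ≤ n) {N : ℕ}
    {X : Fin N → Ω → EuclideanSpace ℝ (Fin (r + 1))}
    (hX : ∀ j, Measurable (X j)) (hperm : PermInvariant (n + 1) (pathLaw μ X))
    (hbridge : ∀ᵐ ω ∂μ, partialSum X (n + 1) ω = 0)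
    (hgp : ∀ᵐ ω ∂μ, InGeneralPosition (fun k => partialSum X k ω) n) :
    μ.real (faceEvent (partialSum X) n i)
      = 2 / ((∏ k ∈ Finset.Ico 1 (r + 1), ((i (k + 1) : ℝ) - (i k : ℝ))) *
          ((n : ℝ) - (i (r + 1) : ℝ) + (i 1 : ℝ) + 1)) := by
  have hsum := sum_measureReal_faceEvent hrn hi hin hX (hperm.mono n.le_succ) hgp
  have hbridge' : ∀ᵐ x ∂pathLaw μ X, walk x (n + 1) = 0 := by
    rw [pathLaw, ae_map_iff (measurable_path hX).aemeasurable
      (measurableSet_eq_fun (measurable_walk _) measurable_const)]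
    simpa only [walk_extendZero] using hbridge
  have hb : ∀ j < r, i (j + 1) - i 1 < i (j + 1 + 1) - i 1 := fun j hj => by
    have := apply_one_le_of_strictMonoOn hi hj.le
    have := lt_apply_succ_of_strictMonoOn hi hj
    omega
  have h1 := apply_one_le_of_strictMonoOn hi le_rfl
  have hshift : ∀ s ≤ n - i (r + 1) + i 1, ∀ i' : ℕ → ℕ,
      (∀ j ≤ r, i' (j + 1) = s + (i (j + 1) - i 1)) → μ.real (faceEvent (partialSum X) n i')
        = (pathLaw μ X).real {x | OnSide 1 (walk x) (fun j => i (j + 1) - i 1) n}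
          + (pathLaw μ X).real {x | OnSide (-1) (walk x) (fun j => i (j + 1) - i 1) n} := by
    intro s hs i' hi'
    have hsn : s + (i (r + 1) - i 1) ≤ n := by omega
    rw [measureReal_faceEvent hX hrn (hperm.mono n.le_succ) hgp hi'
      (fun j hj => Nat.add_lt_add_left (hb j hj) s) hsn,
      measureReal_onSide_bridge hperm hbridge' 1 hb (Nat.sub_self _) hsn,
      measureReal_onSide_bridge hperm hbridge' (-1) hb (Nat.sub_self _) hsn]
  rw [Finset.sum_congr rfl fun s hs => (hshift s (Nat.le_of_lt_succ (Finset.mem_range.1 hs)) _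
    fun _ _ => rfl).trans (hshift (i 1) (by omega) i fun j hj => by
      have := apply_one_le_of_strictMonoOn hi hj; omega).symm,
    Finset.sum_const, Finset.card_range, nsmul_eq_mul] at hsum
  have hcast : ((n - i (r + 1) + i 1 + 1 : ℕ) : ℝ) = (n : ℝ) - i (r + 1) + i 1 + 1 := by
    push_cast [Nat.cast_sub hin]
    ring
  have hpos : (0 : ℝ) < (n : ℝ) - i (r + 1) + i 1 + 1 := by
    rw [← hcast]
    positivity
  rw [hcast] at hsum
  rw [← div_div, ← hsum, mul_div_cancel_left₀ _ hpos.ne']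

end FaceProbabilities

theorem proposition1 {Ω : Type*} [MeasurableSpace Ω] (μ : Measure Ω) [IsProbabilityMeasure μ]
    (d n : ℕ) (hd : 1 ≤ d) (hdn : d ≤ n)
    -- the indices `0 ≤ i 1 < ⋯ < i d ≤ n`
    (i : ℕ → ℕ) (hi : StrictMonoOn i (Set.Icc 1 d)) (hin : i d ≤ n) :
    -- exchangeable increments in general position: sum over all shifts
    (∀ X : Fin n → Ω → EuclideanSpace ℝ (Fin d), (∀ j, Measurable (X j)) →
      Exchangeable μ X →
      (∀ᵐ ω ∂μ, InGeneralPosition (fun k => partialSum X k ω) n) →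
      ∑ s ∈ Finset.range (n - i d + i 1 + 1),
          μ.real (faceEvent (partialSum X) n (fun k => s + (i k - i 1)))
        = 2 / ∏ k ∈ Finset.Ico 1 d, ((i (k + 1) : ℝ) - (i k : ℝ))) ∧
    -- random bridges of length `n + 1`
    (∀ X : Fin (n + 1) → Ω → EuclideanSpace ℝ (Fin d), (∀ j, Measurable (X j)) →
      Exchangeable μ X →
      (∀ᵐ ω ∂μ, partialSum X (n + 1) ω = 0) →
      (∀ᵐ ω ∂μ, InGeneralPosition (fun k => partialSum X k ω) n) →
      μ.real (faceEvent (partialSum X) n i)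
        = 2 / ((∏ k ∈ Finset.Ico 1 d, ((i (k + 1) : ℝ) - (i k : ℝ))) *
            ((n : ℝ) - (i d : ℝ) + (i 1 : ℝ) + 1))) ∧
    -- symmetric random walks
    (∀ X : Fin n → Ω → EuclideanSpace ℝ (Fin d), (∀ j, Measurable (X j)) →
      iIndepFun X μ → (∀ j j', IdentDistrib (X j) (X j') μ μ) →
      (∀ j, NullOnHyperplanes μ (X j)) →
      (∀ j, IdentDistrib (X j) (fun ω => -X j ω) μ μ) →
      μ.real (faceEvent (partialSum X) n i)
        = 2 * (((2 * i 1 - 1)‼ : ℝ) / ((2 * i 1)‼ : ℝ)) *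
            (((2 * n - 2 * i d - 1)‼ : ℝ) / ((2 * n - 2 * i d)‼ : ℝ)) *
            ∏ k ∈ Finset.Ico 1 d, 1 / ((i (k + 1) : ℝ) - (i k : ℝ))) ∧
    -- the same for sign-invariant exchangeable increments in general position
    (∀ X : Fin n → Ω → EuclideanSpace ℝ (Fin d), (∀ j, Measurable (X j)) →
      Exchangeable μ X → SignInvariant μ X →
      (∀ᵐ ω ∂μ, InGeneralPosition (fun k => partialSum X k ω) n) →
      μ.real (faceEvent (partialSum X) n i)
        = 2 * (((2 * i 1 - 1)‼ : ℝ) / ((2 * i 1)‼ : ℝ)) *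
            (((2 * n - 2 * i d - 1)‼ : ℝ) / ((2 * n - 2 * i d)‼ : ℝ)) *
            ∏ k ∈ Finset.Ico 1 d, 1 / ((i (k + 1) : ℝ) - (i k : ℝ))) := by 
  obtain ⟨r, rfl⟩ := Nat.exists_eq_add_of_le' hd
  refine ⟨fun X hX hex hgp => ?_, fun X hX hex hbridge hgp => ?_,
    fun X hX hind hid hnull hsymm => ?_, fun X hX hex hsign hgp => ?_⟩
  · exact sum_measureReal_faceEvent hdn hi hin hX (permInvariant_pathLaw hX hex) hgp
  · exact measureReal_faceEvent_bridge hdn hi hin hX (permInvariant_pathLaw hX hex) hbridge hgp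
  · exact measureReal_faceEvent_of_flipInvariant hdn hi hin hX
      (permInvariant_pathLaw hX (exchangeable_of_iIndepFun hX hind hid))
      (flipInvariant_pathLaw hX (signInvariant_of_iIndepFun hX hind hsymm))
      (ae_inGeneralPosition_of_iIndepFun hX hind hnull)
  · exact measureReal_faceEvent_of_flipInvariant hdn hi hin hX (permInvariant_pathLaw hX hex)
      (flipInvariant_pathLaw hX hsign) hgp
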